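/- Let $d\ge 1$ and let $V(x)=\max\{\|x\|^2-2\sqrt d\,\|x\|,\,0\}$ on $\mathbb R^d$, with $\|\cdot\|$ the Euclidean norm. Put $$\varphi_V(\alpha)=\sum_{x\in\mathbb Z^d}e^{-\alpha V(x)},\qquad C_\rho=\frac{\rho\,e^{-\rho+1/2}}{1-2\rho},\qquad L_V=\sup\{\|x\|:\ x\in\mathbb Z^d,\ V(x)=0\},$$ and let $r_0\approx 0.35542$ be the unique solution in $[0,1]$ of $\frac{r}{(1-r)^2}-r=\frac12$. Let $\theta=\{\theta(x)\}_{x\in\mathbb Z^d}$ be i.i.d. Poisson($\rho$) variables, $\Omega_\theta=\{(x,i):x\in\mathbb Z^d,\ 1\le i\le\theta(x)\}$, and let $E(R)$ be the event that there is an infinite sequence of distinct points $(x_k,i_k)\in\Omega_\theta$ with $\|x_k-x_{k+1}\|\le R$ for all $k$. The density $\rho$ is called good for $V$ if $L_V<1$ or $\mathbb P(E(L_V))=0$. For a locally finite set $\Omega\subset\mathbb R^d$ let $S_\Omega$ be the set of bijections $\sigma:\Omega\to\Omega$ with the topology of pointwise convergence ($\Omega$ discrete) and its Borel $\sigma$-algebra.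 For a compact $\Lambda\subset\mathbb R^d$ and $\xi\in S_\Omega$ let $$S^\xi_{\Omega,\Lambda}=\{\sigma\in S_\Omega:\ \sigma^n(x)=\xi^n(x)\ \text{for all } x\in\Omega\setminus\Lambda,\ n\in\mathbb Z\},\qquad H_\Lambda(\sigma)=\sum_{x\in\Omega\cap\Lambda}\|x-\sigma(x)\|^2,$$ and let $G^\xi_{\Omega,\Lambda}$ be the probability measure on the finite set $S^\xi_{\Omega,\Lambda}$ that gives $\sigma$ a mass proportional to $e^{-\alpha H_\Lambda(\sigma)}$. A probability measure $\mu$ on $S_\Omega$ is a Gibbs measure at temperature $\alpha$ for the quadratic Hamiltonian if $\mu(A)=\int G^\xi_{\Omega,\Lambda}(A)\,d\mu(\xi)$ for every compact $\Lambda\subset\mathbb R^d$ and every measurable $A\subset S_\Omega$. A permutation is a finite cycle permutation if all its cycles are finite. **Theorem.** Let $\rho\in(0,1/2)$ be a good density for $V$ and let $\alpha>0$ satisfy $C_\rho\,\varphi_V(\alpha)<r_0$. Let $\Omega$ be a homogeneous Poisson point process on $\mathbb R^d$ with intensity $\rho$. Then for almost every realization of $\Omega$ there exists exactly one Gibbs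 measure on $S_\Omega$ at temperature $\alpha$ for the quadratic Hamiltonian that is supported on finite cycle permutations (that is, gives them full measure). -/

import Mathlib

open MeasureTheory ProbabilityTheory
open scoped NNReal ENNReal

noncomputable section

namespace SpatialPerm

variable {d : ℕ}

/-! ### The constants -/

/-- The equation `r / (1 - r)² - r = 1/2` has a unique solution in `[0,1]`. -/
theorem existsUnique_r₀ :
    ∃! r : ℝ, r ∈ Set.Icc (0 : ℝ) 1 ∧ r / (1 - r) ^ 2 - r = 1 / 2 := by
  have hc : ContinuousOn (fun r : ℝ => r / (1 - r) ^ 2 - r) (Set.Icc 0 (1 / 2)) := by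
    refine ContinuousOn.sub (ContinuousOn.div continuousOn_id (by fun_prop) ?_) continuousOn_id
    intro x hx
    have : 0 < 1 - x := by linarith [hx.2]
    positivity
  obtain ⟨r, hr, hr'⟩ := intermediate_value_Icc (by norm_num : (0 : ℝ) ≤ 1 / 2) hc
    (show (1 / 2 : ℝ) ∈ _ by constructor <;> norm_num)
  have key : ∀ a : ℝ, a ∈ Set.Icc (0 : ℝ) 1 → a / (1 - a) ^ 2 - a = 1 / 2 →
      a < 1 ∧ a = (a + 1 / 2) * (1 - a) ^ 2 := by
    intro a ha h
    have h1 : a ≠ 1 := by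
      rintro rfl
      norm_num at h
    have h2 : a < 1 := lt_of_le_of_ne ha.2 h1
    refine ⟨h2, ?_⟩
    have h3 : (1 - a) ^ 2 ≠ 0 := pow_ne_zero 2 (by linarith)
    have h4 : a / (1 - a) ^ 2 = a + 1 / 2 := by linarith
    exact (div_eq_iff h3).1 h4
  refine ⟨r, ⟨⟨hr.1, by linarith [hr.2]⟩, hr'⟩, ?_⟩
  rintro s ⟨hs, hs'⟩
  obtain ⟨h1, h2⟩ := key s hs hs'
  obtain ⟨h3, h4⟩ := key r ⟨hr.1, by linarith [hr.2]⟩ hr'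
  have hs0 := hs.1
  have hr0 := hr.1
  have hr2 := hr.2
  have hp : (s - r) * (1 + 3 / 2 * (s + r) - (s ^ 2 + s * r + r ^ 2)) = 0 := by
    nlinarith [h2, h4]
  rcases mul_eq_zero.1 hp with h | h
  · linarith
  · exfalso
    nlinarith [mul_nonneg hs0 hr0, mul_nonneg hs0 (by linarith : (0 : ℝ) ≤ 1 - s),
      mul_nonneg hr0 (by linarith : (0 : ℝ) ≤ 1 / 2 - r),
      mul_nonneg hs0 (by linarith : (0 : ℝ) ≤ 1 / 2 - r)]

/-- `r₀ ≈ 0.35542`, the unique solution in `[0,1]` of `r / (1 - r)² - r = 1/2`. -/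
def r₀ : ℝ := Classical.choose existsUnique_r₀.exists

/-- `C_ρ = ρ e^{-ρ + 1/2} / (1 - 2ρ)`, for `ρ ∈ (0, 1/2)`. -/
def Cρ (ρ : ℝ) : ℝ := ρ * Real.exp (-ρ + 1 / 2) / (1 - 2 * ρ)

/-! ### Potentials on the lattice and good densities -/

/-- A point of `ℤ^d` seen in Euclidean space. -/
def latticePoint (x : Fin d → ℤ) : EuclideanSpace ℝ (Fin d) :=
  WithLp.toLp 2 fun i => (x i : ℝ)

/-- `φ_V(α) = ∑_{x ∈ ℤ^d} e^{-α V(x)}`, with values in `[0,∞]`. -/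
def phi (V : EuclideanSpace ℝ (Fin d) → ℝ) (α : ℝ) : ℝ≥0∞ :=
  ∑' x : Fin d → ℤ, ENNReal.ofReal (Real.exp (-α * V (latticePoint x)))

/-- `L_V = sup {‖x‖ : x ∈ ℤ^d, V(x) = 0}`. -/
def zeroRange (V : EuclideanSpace ℝ (Fin d) → ℝ) : ℝ :=
  sSup {r : ℝ | ∃ x : Fin d → ℤ, V (latticePoint x) = 0 ∧ r = ‖latticePoint x‖}

/-- The law of the i.i.d. Poisson(`ρ`) multiplicities `θ(x)`, `x ∈ ℤ^d`. -/
def multiplicityLaw (d : ℕ) (ρ : ℝ≥0) : Measure ((Fin d → ℤ) → ℕ) :=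
  Measure.infinitePi fun _ => poissonMeasure ρ

/-- `Ω_θ = {(x,i) : 1 ≤ i ≤ θ(x)}`. -/
def discretePoints (θ : (Fin d → ℤ) → ℕ) : Set ((Fin d → ℤ) × ℕ) :=
  {s | 1 ≤ s.2 ∧ s.2 ≤ θ s.1}

/-- The event `E(R)`: there is an infinite sequence of (distinct) points of `Ω_θ` whose
consecutive sites are at distance at most `R`. -/
def percolationEvent (d : ℕ) (R : ℝ) : Set ((Fin d → ℤ) → ℕ) :=
  {θ | ∃ s : ℕ → (Fin d → ℤ) × ℕ, Function.Injective s ∧ (∀ i, s i ∈ discretePoints θ) ∧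
    ∀ i, ‖latticePoint (s i).1 - latticePoint (s (i + 1)).1‖ ≤ R}

/-- `ρ` is a good density for `V`: `L_V < 1` or `ℙ(E(L_V)) = 0`. -/
def IsGoodDensity (V : EuclideanSpace ℝ (Fin d) → ℝ) (ρ : ℝ≥0) : Prop :=
  zeroRange V < 1 ∨ multiplicityLaw d ρ (percolationEvent d (zeroRange V)) = 0

/-- The potential `V(x) = max {‖x‖² - 2 √d ‖x‖, 0}`. -/
def truncatedPotential (d : ℕ) (x : EuclideanSpace ℝ (Fin d)) : ℝ :=
  max (‖x‖ ^ 2 - 2 * √(d : ℝ) * ‖x‖) 0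

/-! ### The Poisson point process -/

/-- The random locally finite set `Ω` is a homogeneous Poisson point process of intensity `ρ`
on `ℝ^d`: the number of points in a bounded Borel set `B` is Poisson with mean `ρ |B|`, and the
numbers of points in disjoint bounded Borel sets are independent. -/
structure IsPoissonProcess {E : Type*} [MeasurableSpace E] (P : Measure E) (ρ : ℝ≥0)
    (Ω : E → Set (EuclideanSpace ℝ (Fin d))) : Prop where
  locallyFinite : ∀ ω, ∀ K : Set (EuclideanSpace ℝ (Fin d)), IsCompact K → (Ω ω ∩ K).Finite
  measurable_count : ∀ B : Set (EuclideanSpace ℝ (Fin d)), MeasurableSet B →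
    Bornology.IsBounded B → Measurable fun ω => (Ω ω ∩ B).ncard
  law_count : ∀ B : Set (EuclideanSpace ℝ (Fin d)), MeasurableSet B →
    Bornology.IsBounded B →
      P.map (fun ω => (Ω ω ∩ B).ncard) = poissonMeasure (ρ * (volume B).toNNReal)
  indep_count : ∀ (n : ℕ) (B : Fin n → Set (EuclideanSpace ℝ (Fin d))),
    (∀ i, MeasurableSet (B i)) → (∀ i, Bornology.IsBounded (B i)) →
      Pairwise (Function.onFun Disjoint B) → iIndepFun (fun i ω => (Ω ω ∩ B i).ncard) P

/-! ### Permutations of a locally finite set, specifications and Gibbs measures -/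

/-- The topology of pointwise convergence on the permutations of `Ω`. For a locally finite
`Ω` (which is discrete) it is the one given by the distance
`d(σ, σ') = 2 ^ (-min {‖x‖ : σ x ≠ σ' x})`. -/
instance permTopology (Ω : Set (EuclideanSpace ℝ (Fin d))) :
    TopologicalSpace (Equiv.Perm Ω) :=
  TopologicalSpace.induced (fun σ : Equiv.Perm Ω => (σ : Ω → Ω)) inferInstance

/-- The Borel σ-algebra on the permutations of `Ω`. -/
instance permMeasurableSpace (Ω : Set (EuclideanSpace ℝ (Fin d))) :
    MeasurableSpace (Equiv.Perm Ω) :=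
  borel (Equiv.Perm Ω)

/-- The quadratic Hamiltonian `H_Λ(σ) = ∑_{x ∈ Ω ∩ Λ} ‖σ(x) - x‖²`; the sum is finite for
`Ω` locally finite and `Λ` compact. -/
def hamiltonian (Ω Λ : Set (EuclideanSpace ℝ (Fin d))) (σ : Equiv.Perm Ω) : ℝ :=
  ∑ᶠ x ∈ {x : Ω | (x : EuclideanSpace ℝ (Fin d)) ∈ Λ},
    ‖(σ x : EuclideanSpace ℝ (Fin d)) - (x : EuclideanSpace ℝ (Fin d))‖ ^ 2

/-- The permutations compatible with the boundary condition `ξ` in volume `Λ`: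
`σⁿ(x) = ξⁿ(x)` for all `x ∈ Ω ∖ Λ` and `n ∈ ℤ`. -/
def compatible (Ω Λ : Set (EuclideanSpace ℝ (Fin d))) (ξ : Equiv.Perm Ω) :
    Set (Equiv.Perm Ω) :=
  {σ | ∀ x : Ω, (x : EuclideanSpace ℝ (Fin d)) ∉ Λ → ∀ n : ℤ, (σ ^ n) x = (ξ ^ n) x}

/-- The Boltzmann weight `e^{-α H_Λ(σ)}`. -/
def boltzmannWeight (Ω Λ : Set (EuclideanSpace ℝ (Fin d))) (α : ℝ) (σ : Equiv.Perm Ω) :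
    ℝ≥0∞ :=
  ENNReal.ofReal (Real.exp (-α * hamiltonian Ω Λ σ))

/-- The normalizing constant `Z_Λ^ξ`. -/
def partitionFunction (Ω Λ : Set (EuclideanSpace ℝ (Fin d))) (α : ℝ) (ξ : Equiv.Perm Ω) :
    ℝ≥0∞ :=
  ∑' σ : compatible Ω Λ ξ, boltzmannWeight Ω Λ α σ

/-- The specification `G_Λ^ξ`: it gives mass `e^{-α H_Λ(σ)} / Z_Λ^ξ` to each `σ` compatible
with `ξ` in `Λ`. -/
def specification (Ω Λ : Set (EuclideanSpace ℝ (Fin d))) (α : ℝ) (ξ : Equiv.Perm Ω) :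
    Measure (Equiv.Perm Ω) :=
  Measure.sum fun σ : compatible Ω Λ ξ =>
    (boltzmannWeight Ω Λ α σ / partitionFunction Ω Λ α ξ) •
      Measure.dirac (σ : Equiv.Perm Ω)

/-- `μ` is a Gibbs measure at temperature `α` for the quadratic Hamiltonian on `Ω`. -/
structure IsGibbs (Ω : Set (EuclideanSpace ℝ (Fin d))) (α : ℝ)
    (μ : Measure (Equiv.Perm Ω)) : Prop where
  isProbability : IsProbabilityMeasure μ
  dlr : ∀ Λ : Set (EuclideanSpace ℝ (Fin d)), IsCompact Λ →
    ∀ A : Set (Equiv.Perm Ω), MeasurableSet A →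
      μ A = ∫⁻ ξ, specification Ω Λ α ξ A ∂μ

/-- A finite cycle permutation: every cycle (including fixed points) is finite. -/
def IsFiniteCyclePerm {Ω : Set (EuclideanSpace ℝ (Fin d))} (σ : Equiv.Perm Ω) : Prop :=
  ∀ x : Ω, {y : Ω | σ.SameCycle x y}.Finite

end SpatialPerm

end

/-! The weights of the permutations of a finite set sum to the permanent of the Gaussian kernel
`e^{-α‖x-y‖²}`, a Gram matrix with nonnegative entries and unit diagonal. Cauchy–Schwarz for
permanents of Gram matrices shows that in every finite volume, prescribing jumps `u i → v i` from
distinct points costs at most the product of their weights (`sum_perm_constrained_le`). The bound is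
uniform in the volume, so infinite cycles and dependence on far-away points are controlled by sums
over self-avoiding paths.

On a locally finite set, being Gibbs amounts to quasi-invariance under finitely supported
permutations (`IsGibbs.isQuasiInvariant`, `IsQuasiInvariant.isGibbs`). This form survives weak
limits, and it transfers the jump bound to every such law on finite cycle permutations
(`IsQuasiInvariant.measure_jumps_le`).

Uniqueness (`IsQuasiInvariant.ext`): take independent samples `σ`, `σ'` of two such laws and the set
reachable from a finite `S` by applying either of them. A path of length `n` can use `σ` or `σ'` at
each step, whence a factor `2 ^ n`, and subcriticality makes the reachable set almost surely finite.
Both samples permute that set, and exchanging their restrictions to it preserves the product law, so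
both laws agree on events that depend on `S`. Existence (`exists_isQuasiInvariant`): finite volume
laws are tight by the jump bound, and the path bound excludes infinite cycles in the limit.

It remains to see that Poisson points are subcritical (`IsPoissonProcess.ae_isSubcritical`).
Rounding points to unit cells and using Poisson factorial moments bounds the mean weight of
self-avoiding `n`-step paths from a cell by `ρ ^ (n + 1) * φ_V(α) ^ n`. This is summable against `2
^ n` once `2ρφ_V(α) < 1`, which follows from the assumption because `ρ ≤ C_ρ` and `r₀ < 1/2`. -/

noncomputable section
namespace SpatialPerm
variable {d : ℕ}

/-! ### Permanents of Gram matrices -/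

/-- The permanent of the matrix `M (a i) (b j)`. -/
def crossPermanent {A ι : Type*} [Fintype ι] [DecidableEq ι] (M : A → A → ℝ) (a b : ι → A) : ℝ :=
  ∑ π : Equiv.Perm ι, ∏ i, M (a i) (b (π i))

/-- A Cauchy–Binet formula for permanents: after expanding, the sum over `l` factorises into entries
of `M`, and the result depends on the two permutations only through `π' * π⁻¹`. -/
theorem crossPermanent_gram {A L ι : Type*} [Fintype L] [Fintype ι] [DecidableEq ι]
    (B : L → A → ℝ) (M : A → A → ℝ) (hM : ∀ x y, M x y = ∑ l, B l x * B l y) (a b : ι → A) :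
    ∑ l : ι → L, (∑ π : Equiv.Perm ι, ∏ i, B (l i) (a (π i))) *
        (∑ π : Equiv.Perm ι, ∏ i, B (l i) (b (π i))) =
      (Fintype.card (Equiv.Perm ι) : ℝ) * crossPermanent M a b := by
  classical
  have h1 : ∀ π π' : Equiv.Perm ι,
      ∑ l : ι → L, (∏ i, B (l i) (a (π i))) * ∏ i, B (l i) (b (π' i)) =
        ∏ i, M (a i) (b ((π' * π⁻¹) i)) := by
    intro π π'
    simp_rw [← Finset.prod_mul_distrib]
    have h2 := Finset.prod_univ_sum (fun _ : ι => (Finset.univ : Finset L))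
      (fun i l => B l (a (π i)) * B l (b (π' i)))
    rw [Fintype.piFinset_univ] at h2
    rw [← h2]
    simp_rw [← hM]
    rw [← Equiv.prod_comp π (fun i => M (a i) (b ((π' * π⁻¹) i)))]
    simp
  simp_rw [Finset.sum_mul_sum]
  rw [Finset.sum_comm]
  simp_rw [Finset.sum_comm (s := (Finset.univ : Finset (ι → L))), h1]
  have h3 : ∀ π : Equiv.Perm ι, ∑ π' : Equiv.Perm ι, ∏ i, M (a i) (b ((π' * π⁻¹) i)) =
      crossPermanent M a b := fun π =>
    Equiv.sum_comp (Equiv.mulRight π⁻¹) (fun π' : Equiv.Perm ι => ∏ i, M (a i) (b (π' i)))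
  simp only [h3, Finset.sum_const, Finset.card_univ, nsmul_eq_mul]

/-- Cauchy–Schwarz over the label tuples `l`; the common factorial factor cancels. -/
theorem crossPermanent_sq_le {A L ι : Type*} [Fintype L] [Fintype ι] [DecidableEq ι]
    (B : L → A → ℝ) (M : A → A → ℝ) (hM : ∀ x y, M x y = ∑ l, B l x * B l y) (a b : ι → A) :
    crossPermanent M a b ^ 2 ≤ crossPermanent M a a * crossPermanent M b b := by
  have hc : (0 : ℝ) < Fintype.card (Equiv.Perm ι) := by exact_mod_cast Fintype.card_pos
  have h := Finset.sum_mul_sq_le_sq_mul_sq (Finset.univ : Finset (ι → L))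
    (fun l => ∑ π : Equiv.Perm ι, ∏ i, B (l i) (a (π i)))
    (fun l => ∑ π : Equiv.Perm ι, ∏ i, B (l i) (b (π i)))
  simp only [sq (∑ π : Equiv.Perm ι, _)] at h
  rw [crossPermanent_gram B M hM, crossPermanent_gram B M hM, crossPermanent_gram B M hM] at h
  nlinarith [pow_pos hc 2, h]

/-- Extending by the identity embeds the permutations of a subset into those of `A`, without
changing weights since the diagonal is `1`; the remaining terms are nonnegative. -/
theorem crossPermanent_self_le {A ι : Type*} [Fintype A] [DecidableEq A] [Fintype ι]
    [DecidableEq ι] (M : A → A → ℝ) (h0 : ∀ x y, 0 ≤ M x y) (h1 : ∀ x, M x x = 1)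
    (a : ι → A) (ha : Function.Injective a) :
    crossPermanent M a a ≤ ∑ σ : Equiv.Perm A, ∏ x, M x (σ x) := by
  classical
  let e : ι ≃ {x // x ∈ Set.range a} := Equiv.ofInjective a ha
  let F : Equiv.Perm ι → Equiv.Perm A := fun π => π.extendDomain e
  have hF : Function.Injective F := Equiv.Perm.extendDomainHom_injective e
  have hW : ∀ π, ∏ i, M (a i) (a (π i)) = ∏ x, M x (F π x) := by
    intro π
    have hi : ∀ i, F π (a i) = a (π i) := fun i => Equiv.Perm.extendDomain_apply_image π e i
    rw [← Finset.prod_subset (Finset.subset_univ (Finset.univ.image a)),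
      Finset.prod_image (fun x _ y _ h => ha h)]
    · exact Finset.prod_congr rfl fun i _ => by rw [hi]
    · intro x _ hx
      rw [Equiv.Perm.extendDomain_apply_not_subtype _ _ (by simpa using hx), h1]
  unfold crossPermanent
  simp_rw [hW]
  rw [← Finset.sum_image (f := fun σ : Equiv.Perm A => ∏ x, M x (σ x)) (fun x _ y _ h => hF h)]
  exact Finset.sum_le_sum_of_subset_of_nonneg (Finset.subset_univ _)
    fun σ _ _ => Finset.prod_nonneg fun x _ => h0 _ _

/-- For a nonnegative Gram matrix with unit diagonal, prescribing some values of a random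
permutation costs at most the product of the corresponding entries. -/
theorem sum_perm_constrained_le {A L s : Type*} [Fintype A] [DecidableEq A] [Fintype L]
    [Fintype s] (B : L → A → ℝ) (M : A → A → ℝ) (hM : ∀ x y, M x y = ∑ l, B l x * B l y)
    (h0 : ∀ x y, 0 ≤ M x y) (h1 : ∀ x, M x x = 1) (u v : s → A) (hu : Function.Injective u)
    [DecidablePred fun σ : Equiv.Perm A => ∀ i, σ (u i) = v i] :
    ∑ σ : Equiv.Perm A with ∀ i, σ (u i) = v i, ∏ x, M x (σ x) ≤
      (∏ i, M (u i) (v i)) * ∑ σ : Equiv.Perm A, ∏ x, M x (σ x) := by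
  classical
  have hZ : 0 ≤ ∑ σ : Equiv.Perm A, ∏ x, M x (σ x) :=
    Finset.sum_nonneg fun σ _ => Finset.prod_nonneg fun x _ => h0 _ _
  by_cases hv : Function.Injective v
  swap
  · rw [Finset.filter_false_of_mem]
    · simpa using mul_nonneg (Finset.prod_nonneg fun i _ => h0 _ _) hZ
    · intro σ _ h
      exact hv fun i j hij => hu (σ.injective (by rw [h, h, hij]))
  -- The rows and columns left after deleting `u` and `v`. They have equal cardinality, so an
  -- arbitrary identification `e` writes the minor as a cross permanent, which Cauchy–Schwarz
  -- compares with two principal ones.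
  let ι := {x : A // x ∉ Finset.univ.image u}
  let ι' := {x : A // x ∉ Finset.univ.image v}
  have hcard : Fintype.card ι = Fintype.card ι' := by
    simp only [ι, ι', Fintype.card_subtype_compl, Fintype.card_coe,
      Finset.card_image_of_injective _ hu, Finset.card_image_of_injective _ hv]
  let e : ι ≃ ι' := Fintype.equivOfCardEq hcard
  let a : ι → A := Subtype.val
  let b : ι → A := fun i => (e i : A)
  have ha : Function.Injective a := Subtype.val_injective
  have hb : Function.Injective b := fun x y h => e.injective (Subtype.val_injective h)
  have hab : crossPermanent M a b ≤ ∑ σ : Equiv.Perm A, ∏ x, M x (σ x) := by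
    have h2 := crossPermanent_sq_le B M hM a b
    have h3 := crossPermanent_self_le M h0 h1 a ha
    have h4 := crossPermanent_self_le M h0 h1 b hb
    have h5 : 0 ≤ crossPermanent M b b :=
      Finset.sum_nonneg fun σ _ => Finset.prod_nonneg fun x _ => h0 _ _
    refine abs_le_of_sq_le_sq' ?_ hZ |>.2
    calc _ ≤ _ := h2
      _ ≤ (∑ σ : Equiv.Perm A, ∏ x, M x (σ x)) * (∑ σ : Equiv.Perm A, ∏ x, M x (σ x)) :=
        mul_le_mul h3 h4 h5 hZ
      _ = _ := by ring
  have hmem : ∀ σ : Equiv.Perm A, (∀ i, σ (u i) = v i) → ∀ x,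
      x ∉ Finset.univ.image u ↔ σ x ∉ Finset.univ.image v := by
    intro σ hσ x
    simp only [Finset.mem_image, Finset.mem_univ, true_and, not_exists]
    constructor
    · intro h i hi
      exact h i (σ.injective (by rw [hσ, hi]))
    · intro h i hi
      exact h i (by rw [← hσ, hi])
  let G : ∀ σ : Equiv.Perm A, (∀ i, σ (u i) = v i) → Equiv.Perm ι := fun σ hσ =>
    (σ.subtypeEquiv (hmem σ hσ)).trans e.symm
  have hG : ∀ σ hσ i, b (G σ hσ i) = σ (a i) := by
    intro σ hσ i
    simp only [b, G, a, Equiv.trans_apply, Equiv.apply_symm_apply]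
    rfl
  calc ∑ σ : Equiv.Perm A with ∀ i, σ (u i) = v i, ∏ x, M x (σ x)
      ≤ ∑ π : Equiv.Perm ι, (∏ i, M (u i) (v i)) * ∏ i, M (a i) (b (π i)) := by
        let G' : Equiv.Perm A → Equiv.Perm ι := fun σ =>
          if h : ∀ i, σ (u i) = v i then G σ h else 1
        have hG' : ∀ σ, (∀ i, σ (u i) = v i) → ∀ i, b (G' σ i) = σ (a i) := by
          intro σ hσ i
          simp only [G', dif_pos hσ, hG]
        refine le_trans (le_of_eq ?_) (Finset.sum_le_sum_of_subset_of_nonneg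
          (Finset.subset_univ ((Finset.univ.filter fun σ : Equiv.Perm A =>
            ∀ i, σ (u i) = v i).image G')) fun π _ _ => mul_nonneg
            (Finset.prod_nonneg fun i _ => h0 _ _) (Finset.prod_nonneg fun i _ => h0 _ _))
        rw [Finset.sum_image]
        · refine Finset.sum_congr rfl fun σ hσ => ?_
          have hσ' := (Finset.mem_filter.1 hσ).2
          rw [← Finset.prod_mul_prod_compl (Finset.univ.image u),
            Finset.prod_image (fun x _ y _ h => hu h)]
          congr 1
          · exact Finset.prod_congr rfl fun i _ => by rw [hσ']
          · rw [Finset.prod_subtype (Finset.univ.image u)ᶜ (p := fun x =>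
              x ∉ Finset.univ.image u) (by simp) (fun x => M x (σ x))]
            · exact Finset.prod_congr rfl fun i _ => by rw [hG' σ hσ']
        · intro σ hσ σ' hσ' h
          have h2 := (Finset.mem_filter.1 hσ).2
          have h3 := (Finset.mem_filter.1 hσ').2
          ext x
          by_cases hx : x ∈ Finset.univ.image u
          · obtain ⟨i, -, rfl⟩ := Finset.mem_image.1 hx
            rw [h2, h3]
          · have := hG' σ h2 ⟨x, hx⟩
            rw [h, hG' σ' h3] at this
            exact this.symm
    _ = (∏ i, M (u i) (v i)) * crossPermanent M a b := by rw [← Finset.mul_sum]; rfl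
    _ ≤ _ := mul_le_mul_of_nonneg_left hab (Finset.prod_nonneg fun i _ => h0 _ _)

/-! ### The Gaussian kernel -/

/-- By the Schur product theorem each entrywise power of a Gram matrix is positive semidefinite, and
the exponential series has nonnegative coefficients. -/
theorem posSemidef_exp_inner {A : Type*} [Fintype A] [DecidableEq A] (α : ℝ) (hα : 0 ≤ α)
    (p : A → EuclideanSpace ℝ (Fin d)) :
    (Matrix.of fun x y => Real.exp (α * inner ℝ (p x) (p y))).PosSemidef := by
  have hg := Matrix.posSemidef_gram ℝ p
  have hpow : ∀ n : ℕ, (Matrix.of fun x y => (inner ℝ (p x) (p y) : ℝ) ^ n).PosSemidef := by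
    intro n
    induction n with
    | zero =>
      have : (Matrix.of fun x y => (inner ℝ (p x) (p y) : ℝ) ^ 0) =
          Matrix.vecMulVec (fun _ : A => (1 : ℝ)) (star fun _ : A => (1 : ℝ)) := by
        ext x y; simp [Matrix.vecMulVec_apply]
      rw [this]
      exact Matrix.posSemidef_vecMulVec_self_star _
    | succ n ih =>
      have h := ih.hadamard hg
      refine (congrArg Matrix.PosSemidef ?_).mp h
      ext x y
      simp [Matrix.hadamard_apply, Matrix.gram_apply, pow_succ]
  refine Matrix.PosSemidef.of_dotProduct_mulVec_nonneg ?_ fun c => ?_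
  · ext x y
    simp [Matrix.conjTranspose_apply, real_inner_comm]
  · have hs : HasSum (fun n : ℕ => ∑ x, ∑ y, c x * (c y * ((α * inner ℝ (p x) (p y)) ^ n / n.factorial)))
        (∑ x, ∑ y, c x * (c y * Real.exp (α * inner ℝ (p x) (p y)))) := by
      refine hasSum_sum fun x _ => hasSum_sum fun y _ => ?_
      refine ((HasSum.mul_left _ ?_).mul_left _)
      have := NormedSpace.expSeries_div_hasSum_exp (α * inner ℝ (p x) (p y))
      rwa [← Real.exp_eq_exp_ℝ] at this
    have h2 : star c ⬝ᵥ (Matrix.of fun x y => Real.exp (α * inner ℝ (p x) (p y))).mulVec c =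
        ∑ x, ∑ y, c x * (c y * Real.exp (α * inner ℝ (p x) (p y))) := by
      simp [dotProduct, Matrix.mulVec, Finset.mul_sum, mul_comm]
    rw [h2, ← hs.tsum_eq]
    refine tsum_nonneg fun n => ?_
    have h3 := (hpow n).dotProduct_mulVec_nonneg c
    have h4 : ∑ x, ∑ y, c x * (c y * ((α * inner ℝ (p x) (p y)) ^ n / n.factorial)) =
        α ^ n / n.factorial *
          (star c ⬝ᵥ (Matrix.of fun x y => (inner ℝ (p x) (p y) : ℝ) ^ n).mulVec c) := by
      simp only [dotProduct, Matrix.mulVec, Finset.mul_sum, Matrix.of_apply, star_trivial, mul_pow]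
      refine Finset.sum_congr rfl fun x _ => Finset.sum_congr rfl fun y _ => by ring
    rw [h4]
    exact mul_nonneg (by positivity) h3

/-- Since `-α‖y-x‖² = -α‖x‖² - α‖y‖² + 2α⟨x,y⟩`, the kernel is a diagonal rescaling of the previous
one with parameter `2α`. -/
theorem gaussian_gram {A : Type*} [Fintype A] [DecidableEq A] (α : ℝ) (hα : 0 ≤ α)
    (p : A → EuclideanSpace ℝ (Fin d)) :
    ∃ (m : ℕ) (B : Fin m → A → ℝ),
      ∀ x y, Real.exp (-α * ‖p y - p x‖ ^ 2) = ∑ l, B l x * B l y := by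
  obtain ⟨m, B, hB⟩ := Matrix.posSemidef_iff_eq_sum_vecMulVec.1
    (posSemidef_exp_inner (2 * α) (by linarith) p)
  refine ⟨m, fun l x => Real.exp (-α * ‖p x‖ ^ 2) * B l x, fun x y => ?_⟩
  have h := congrFun (congrFun hB x) y
  simp only [Matrix.of_apply, Matrix.sum_apply, Matrix.vecMulVec_apply,
    star_trivial] at h
  have h2 : ∀ l, Real.exp (-α * ‖p x‖ ^ 2) * B l x * (Real.exp (-α * ‖p y‖ ^ 2) * B l y) =
      Real.exp (-α * ‖p x‖ ^ 2) * Real.exp (-α * ‖p y‖ ^ 2) * (B l x * B l y) := fun l => by ring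
  simp_rw [h2, ← Finset.mul_sum, ← h, ← Real.exp_add]
  rw [norm_sub_sq_real, real_inner_comm]
  ring_nf

end SpatialPerm
end

noncomputable section
namespace SpatialPerm
variable {d : ℕ}

/-! ### Weights -/

variable {Ω : Set (EuclideanSpace ℝ (Fin d))}

/-- The weight `e^{-α ‖(y : EuclideanSpace ℝ (Fin d)) - x‖²}` of a jump from `x` to `y`. -/
def jumpWeight (α : ℝ) (x y : Ω) : ℝ≥0∞ :=
  ENNReal.ofReal (Real.exp (-α * ‖(y : EuclideanSpace ℝ (Fin d)) - x‖ ^ 2))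

theorem jumpWeight_self (α : ℝ) (x : Ω) : jumpWeight α x x = 1 := by
  simp [jumpWeight]

theorem jumpWeight_ne_zero (α : ℝ) (x y : Ω) : jumpWeight α x y ≠ 0 := by
  simp [jumpWeight, Real.exp_pos]

theorem jumpWeight_ne_top (α : ℝ) (x y : Ω) : jumpWeight α x y ≠ ∞ := by
  simp [jumpWeight]

theorem jumpWeight_comm (α : ℝ) (x y : Ω) :
    jumpWeight α x y = jumpWeight α y x := by
  simp [jumpWeight, norm_sub_rev]

/-- The weight of a permutation of a finite subset of `Ω`. -/
def permWeight (α : ℝ) (K : Finset Ω) (τ : Equiv.Perm K) : ℝ≥0∞ :=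
  ∏ x : K, jumpWeight α (x : Ω) (τ x : Ω)

theorem permWeight_ne_zero (α : ℝ) (K : Finset Ω) (τ : Equiv.Perm K) : permWeight α K τ ≠ 0 :=
  Finset.prod_ne_zero_iff.2 fun _ _ => jumpWeight_ne_zero _ _ _

theorem permWeight_ne_top (α : ℝ) (K : Finset Ω) (τ : Equiv.Perm K) : permWeight α K τ ≠ ∞ :=
  ENNReal.prod_ne_top fun _ _ => jumpWeight_ne_top _ _ _

theorem sum_permWeight_ne_zero (α : ℝ) (K : Finset Ω) : ∑ τ, permWeight α K τ ≠ 0 := by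
  intro h
  exact permWeight_ne_zero α K 1 (Finset.sum_eq_zero_iff.1 h 1 (Finset.mem_univ _))

theorem sum_permWeight_ne_top (α : ℝ) (K : Finset Ω) : ∑ τ, permWeight α K τ ≠ ∞ :=
  ENNReal.sum_ne_top.2 fun _ _ => permWeight_ne_top _ _ _

open Classical in
theorem sum_permWeight_constrained_le {α : ℝ} (hα : 0 ≤ α) (K : Finset Ω) {s : Type*} [Fintype s]
    (u v : s → K) (hu : Function.Injective u) :
    ∑ τ : Equiv.Perm K with ∀ i, τ (u i) = v i, permWeight α K τ ≤
      (∏ i, jumpWeight α (u i : Ω) (v i : Ω)) * ∑ τ, permWeight α K τ := by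
  obtain ⟨m, B, hB⟩ := gaussian_gram α hα (fun x : K => ((x : Ω) : EuclideanSpace ℝ (Fin d)))
  have h := sum_perm_constrained_le B
    (fun x y : K => Real.exp (-α * ‖((y : Ω) : EuclideanSpace ℝ (Fin d)) - (x : Ω)‖ ^ 2)) hB
    (fun x y => (Real.exp_pos _).le) (fun x => by simp) u v hu
  have hw : ∀ τ : Equiv.Perm K, permWeight α K τ = ENNReal.ofReal (∏ x : K,
      Real.exp (-α * ‖((τ x : Ω) : EuclideanSpace ℝ (Fin d)) - (x : Ω)‖ ^ 2)) := by
    intro τ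
    rw [ENNReal.ofReal_prod_of_nonneg fun _ _ => (Real.exp_pos _).le]
    rfl
  have hw' : (∏ i, jumpWeight α (u i : Ω) (v i : Ω)) = ENNReal.ofReal (∏ i,
      Real.exp (-α * ‖((v i : Ω) : EuclideanSpace ℝ (Fin d)) - (u i : Ω)‖ ^ 2)) := by
    rw [ENNReal.ofReal_prod_of_nonneg fun _ _ => (Real.exp_pos _).le]
    rfl
  simp_rw [hw, hw']
  rw [← ENNReal.ofReal_sum_of_nonneg fun _ _ => Finset.prod_nonneg fun _ _ => (Real.exp_pos _).le,
    ← ENNReal.ofReal_sum_of_nonneg fun _ _ => Finset.prod_nonneg fun _ _ => (Real.exp_pos _).le,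
    ← ENNReal.ofReal_mul (Finset.prod_nonneg fun _ _ => (Real.exp_pos _).le)]
  exact ENNReal.ofReal_le_ofReal h

/-! ### The topological group of permutations -/

theorem discreteTopology_of_locallyFinite
    (hΩ : ∀ K : Set (EuclideanSpace ℝ (Fin d)), IsCompact K → (Ω ∩ K).Finite) :
    DiscreteTopology Ω := by
  rw [discreteTopology_subtype_iff']
  intro x hx
  have hfin : (Ω ∩ Metric.closedBall x 1).Finite := hΩ _ (isCompact_closedBall x 1)
  refine ⟨Metric.ball x 1 \ ((Ω ∩ Metric.closedBall x 1) \ {x}),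
    Metric.isOpen_ball.sdiff (hfin.subset Set.sdiff_subset).isClosed, ?_⟩
  ext y
  simp only [Set.mem_inter_iff, Set.mem_sdiff, Metric.mem_ball, Metric.mem_closedBall,
    Set.mem_singleton_iff]
  constructor
  · rintro ⟨⟨h1, h2⟩, h3⟩
    by_contra h4
    exact h2 ⟨⟨h3, h1.le⟩, h4⟩
  · rintro rfl
    simp [hx]

theorem countable_of_locallyFinite
    (hΩ : ∀ K : Set (EuclideanSpace ℝ (Fin d)), IsCompact K → (Ω ∩ K).Finite) : Countable Ω := by
  have h : Ω = ⋃ n : ℕ, Ω ∩ Metric.closedBall 0 n := by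
    rw [← Set.inter_iUnion, Metric.iUnion_closedBall_nat, Set.inter_univ]
  have h2 : Ω.Countable := by
    rw [h]
    exact Set.countable_iUnion fun n => (hΩ _ (isCompact_closedBall 0 n)).countable
  exact h2.to_subtype

instance : BorelSpace (Equiv.Perm Ω) := ⟨rfl⟩

theorem continuous_perm_apply (x : Ω) : Continuous fun σ : Equiv.Perm Ω => σ x :=
  (continuous_apply x).comp continuous_induced_dom

instance : T2Space (Equiv.Perm Ω) :=
  T2Space.of_injective_continuous (f := fun σ : Equiv.Perm Ω => (σ : Ω → Ω))
    DFunLike.coe_injective continuous_induced_dom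

/-- The permutations with prescribed values on a finite set. -/
def cylinder (S : Finset Ω) (f : Ω → Ω) : Set (Equiv.Perm Ω) :=
  {σ | ∀ x ∈ S, σ x = f x}

/-- The permutations fixing each point of a finite set. -/
def fixing (K : Finset Ω) : Set (Equiv.Perm Ω) := cylinder K id

theorem mem_fixing {K : Finset Ω} {σ : Equiv.Perm Ω} : σ ∈ fixing K ↔ ∀ x ∈ K, σ x = x := Iff.rfl

theorem isPiSystem_cylinder :
    IsPiSystem {B : Set (Equiv.Perm Ω) | ∃ S f, B = cylinder S f} := by
  classical
  rintro _ ⟨S, f, rfl⟩ _ ⟨S', f', rfl⟩ ⟨σ, hσ, hσ'⟩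
  refine ⟨S ∪ S', σ, ?_⟩
  ext τ
  simp only [cylinder, Set.mem_inter_iff, Set.mem_ofPred_eq, Finset.mem_union] at *
  constructor
  · rintro ⟨h1, h2⟩ x (hx | hx)
    · rw [h1 x hx, hσ x hx]
    · rw [h2 x hx, hσ' x hx]
  · intro h
    exact ⟨fun x hx => (h x (Or.inl hx)).trans (hσ x hx),
      fun x hx => (h x (Or.inr hx)).trans (hσ' x hx)⟩

section Discrete

variable [DiscreteTopology Ω]

theorem isOpen_perm_apply_eq (x y : Ω) : IsOpen {σ : Equiv.Perm Ω | σ x = y} :=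
  (isOpen_discrete {y}).preimage (continuous_perm_apply x)

instance : IsTopologicalGroup (Equiv.Perm Ω) where
  continuous_mul := by
    refine continuous_induced_rng.2 (continuous_pi fun x => ?_)
    refine continuous_discrete_rng.2 fun z => ?_
    have : (fun p : Equiv.Perm Ω × Equiv.Perm Ω => (p.1 * p.2 : Equiv.Perm Ω) x) ⁻¹' {z} =
        ⋃ y : Ω, {σ : Equiv.Perm Ω | σ y = z} ×ˢ {σ : Equiv.Perm Ω | σ x = y} := by
      ext p
      simp only [Set.mem_preimage, Set.mem_singleton_iff, Equiv.Perm.mul_apply, Set.mem_iUnion,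
        Set.mem_prod, Set.mem_ofPred_eq]
      exact ⟨fun h => ⟨_, h, rfl⟩, fun ⟨y, h1, h2⟩ => by rw [h2, h1]⟩
    change IsOpen ((fun p : Equiv.Perm Ω × Equiv.Perm Ω => (p.1 * p.2 : Equiv.Perm Ω) x) ⁻¹' {z})
    rw [this]
    exact isOpen_iUnion fun y => (isOpen_perm_apply_eq y z).prod (isOpen_perm_apply_eq x y)
  continuous_inv := by
    refine continuous_induced_rng.2 (continuous_pi fun x => ?_)
    refine continuous_discrete_rng.2 fun z => ?_
    have : (fun σ : Equiv.Perm Ω => σ⁻¹ x) ⁻¹' {z} = {σ : Equiv.Perm Ω | σ z = x} := by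
      ext σ
      simp only [Set.mem_preimage, Set.mem_singleton_iff, Set.mem_ofPred_eq,
        Equiv.Perm.inv_eq_iff_eq]
      exact eq_comm
    change IsOpen ((fun σ : Equiv.Perm Ω => σ⁻¹ x) ⁻¹' {z})
    rw [this]
    exact isOpen_perm_apply_eq z x

theorem isClopen_cylinder (S : Finset Ω) (f : Ω → Ω) : IsClopen (cylinder S f) := by
  have : cylinder S f = ⋂ x ∈ S, (fun σ : Equiv.Perm Ω => σ x) ⁻¹' {f x} := by
    ext σ; simp [cylinder]
  rw [this]
  exact S.finite_toSet.isClopen_biInter fun x _ =>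
    (isClopen_discrete {f x}).preimage (continuous_perm_apply x)

theorem measurableSet_cylinder (S : Finset Ω) (f : Ω → Ω) : MeasurableSet (cylinder S f) :=
  (isClopen_cylinder S f).isOpen.measurableSet

theorem isTopologicalBasis_cylinder : TopologicalSpace.IsTopologicalBasis
    {B : Set (Equiv.Perm Ω) | ∃ S f, B = cylinder S f} := by
  refine TopologicalSpace.isTopologicalBasis_of_isOpen_of_nhds ?_ ?_
  · rintro _ ⟨S, f, rfl⟩
    exact (isClopen_cylinder S f).isOpen
  · intro σ U hσ hU
    obtain ⟨W, hW, rfl⟩ := isOpen_induced_iff.1 hU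
    have hn : W ∈ nhds (σ : Ω → Ω) := hW.mem_nhds hσ
    rw [nhds_pi, Filter.mem_pi'] at hn
    obtain ⟨S, t, ht, hSt⟩ := hn
    refine ⟨cylinder S σ, ⟨S, σ, rfl⟩, fun _ _ => rfl, fun τ hτ => hSt fun x hx => ?_⟩
    change τ x ∈ t x
    rw [hτ x hx]
    exact mem_of_mem_nhds (ht x)

instance [Countable Ω] : SecondCountableTopology (Equiv.Perm Ω) :=
  Topology.IsInducing.secondCountableTopology (f := fun σ : Equiv.Perm Ω => (σ : Ω → Ω)) ⟨rfl⟩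

theorem borel_eq_generateFrom_cylinder [Countable Ω] :
    permMeasurableSpace Ω = MeasurableSpace.generateFrom
      {B : Set (Equiv.Perm Ω) | ∃ S f, B = cylinder S f} :=
  isTopologicalBasis_cylinder.borel_eq_generateFrom

theorem measure_ext_cylinder [Countable Ω] {μ ν : Measure (Equiv.Perm Ω)} [IsFiniteMeasure μ]
    (h : ∀ S f, μ (cylinder S f) = ν (cylinder S f)) : μ = ν := by
  refine ext_of_generate_finite _ borel_eq_generateFrom_cylinder isPiSystem_cylinder ?_ ?_
  · rintro _ ⟨S, f, rfl⟩
    exact h S f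
  · have := h ∅ id
    simpa [cylinder] using this

end Discrete

/-! ### Quasi-invariance under finitely supported permutations -/

/-- Composing with a finitely supported permutation multiplies the mass of a set of permutations
that fix its support by the weight. -/
def IsQuasiInvariant (α : ℝ) (μ : Measure (Equiv.Perm Ω)) : Prop :=
  ∀ (K : Finset Ω) (τ : Equiv.Perm Ω), (∀ x ∉ K, τ x = x) → ∀ B, MeasurableSet B →
    B ⊆ fixing K → μ ((fun σ => τ⁻¹ * σ) ⁻¹' B) = (∏ x ∈ K, jumpWeight α x (τ x)) * μ B

theorem boltzmannWeight_eq_prod {Λ : Set (EuclideanSpace ℝ (Fin d))} {V : Finset Ω}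
    (hV : ∀ x : Ω, x ∈ V ↔ (x : EuclideanSpace ℝ (Fin d)) ∈ Λ) (α : ℝ) (σ : Equiv.Perm Ω) :
    boltzmannWeight Ω Λ α σ = ∏ x ∈ V, jumpWeight α x (σ x) := by
  have hs : {x : Ω | (x : EuclideanSpace ℝ (Fin d)) ∈ Λ} = (V : Set Ω) := by
    ext x; simp [hV]
  rw [boltzmannWeight, hamiltonian, hs, finsum_mem_coe_finset, Finset.mul_sum, Real.exp_sum,
    ENNReal.ofReal_prod_of_nonneg fun _ _ => (Real.exp_pos _).le]
  rfl

theorem specification_apply (Λ : Set (EuclideanSpace ℝ (Fin d))) (α : ℝ) (ξ : Equiv.Perm Ω)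
    {A : Set (Equiv.Perm Ω)} (hA : MeasurableSet A) :
    specification Ω Λ α ξ A = ∑' σ : Equiv.Perm Ω, (compatible Ω Λ ξ).indicator (fun σ =>
      boltzmannWeight Ω Λ α σ / partitionFunction Ω Λ α ξ * A.indicator 1 σ) σ := by
  rw [specification, Measure.sum_apply _ hA, ← tsum_subtype]
  refine tsum_congr fun σ => ?_
  simp [Measure.smul_apply, Measure.dirac_apply' _ hA]

theorem zpow_apply_mem {T : Set Ω} {ξ : Equiv.Perm Ω} (h : ∀ x ∈ T, ξ x ∈ T ∧ ξ⁻¹ x ∈ T) {x : Ω}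
    (hx : x ∈ T) (n : ℤ) : (ξ ^ n) x ∈ T := by
  induction n using Int.induction_on with
  | zero => simpa using hx
  | succ n ih => rw [add_comm, zpow_add, zpow_one]; exact (h _ ih).1
  | pred n ih =>
    rw [sub_eq_add_neg, add_comm, zpow_add, zpow_neg, zpow_one]; exact (h _ ih).2

theorem zpow_apply_eq {T : Set Ω} {ξ σ : Equiv.Perm Ω} (h : ∀ x ∈ T, ξ x ∈ T ∧ ξ⁻¹ x ∈ T)
    (hσ : ∀ x ∈ T, σ x = ξ x) {x : Ω} (hx : x ∈ T) (n : ℤ) : (σ ^ n) x = (ξ ^ n) x := by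
  have hinv : ∀ x ∈ T, σ⁻¹ x = ξ⁻¹ x := by
    intro x hx
    rw [Equiv.Perm.inv_eq_iff_eq, hσ _ (h x hx).2]
    simp
  induction n using Int.induction_on with
  | zero => simp
  | succ n ih =>
    rw [add_comm, zpow_add, zpow_add, zpow_one, zpow_one, Equiv.Perm.mul_apply,
      Equiv.Perm.mul_apply, ih, hσ _ (zpow_apply_mem h hx _)]
  | pred n ih =>
    rw [sub_eq_add_neg, add_comm, zpow_add, zpow_add, zpow_neg_one, zpow_neg_one,
      Equiv.Perm.mul_apply, Equiv.Perm.mul_apply, ih, hinv _ (zpow_apply_mem h hx _)]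

open Classical in
theorem prod_jumpWeight_ofSubtype (α : ℝ) (K : Finset Ω) (τ : Equiv.Perm K) :
    ∏ x ∈ K, jumpWeight α x (Equiv.Perm.ofSubtype τ x) = permWeight α K τ := by
  rw [permWeight, ← Finset.prod_coe_sort]
  exact Finset.prod_congr rfl fun x _ => by rw [Equiv.Perm.ofSubtype_apply_coe]

variable [DiscreteTopology Ω]

/-- Apply the DLR equation in the volume `K`. If `σ` fixes `K`, then `σ` and `τ * σ` have the same
iterates off `K`, so they are compatible with the same `ξ`; their weights are `1` and the weight of
`τ`. The identity then holds for each `ξ` by reindexing the sum. -/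
theorem IsGibbs.isQuasiInvariant {α : ℝ} {μ : Measure (Equiv.Perm Ω)} (hμ : IsGibbs Ω α μ) :
    IsQuasiInvariant α μ := by
  classical
  intro K τ hτ B hB hBK
  let Λ : Set (EuclideanSpace ℝ (Fin d)) := Subtype.val '' (K : Set Ω)
  have hΛ : IsCompact Λ := (K.finite_toSet.image _).isCompact
  have hV : ∀ x : Ω, x ∈ K ↔ (x : EuclideanSpace ℝ (Fin d)) ∈ Λ := by
    intro x; simp [Λ]
  have hBm : MeasurableSet ((fun σ => τ⁻¹ * σ) ⁻¹' B) :=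
    (continuous_const_mul τ⁻¹).measurable hB
  rw [hμ.dlr Λ hΛ _ hBm, hμ.dlr Λ hΛ _ hB, ← lintegral_const_mul' _ _
    (ENNReal.prod_ne_top fun _ _ => jumpWeight_ne_top _ _ _)]
  refine lintegral_congr fun ξ => ?_
  rw [specification_apply _ _ _ hBm, specification_apply _ _ _ hB, ← ENNReal.tsum_mul_left,
    ← (Equiv.mulLeft τ).tsum_eq]
  refine tsum_congr fun σ => ?_
  simp only [Equiv.coe_mulLeft]
  have hm : τ * σ ∈ (fun σ => τ⁻¹ * σ) ⁻¹' B ↔ σ ∈ B := by simp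
  by_cases hσ : σ ∈ B
  swap
  · simp [Set.indicator, hσ]
  have hfix : ∀ x ∈ K, σ x = x := hBK hσ
  have hfix' : ∀ x ∈ K, σ⁻¹ x = x := fun x hx => by
    rw [Equiv.Perm.inv_eq_iff_eq, hfix x hx]
  have hT : ∀ x ∈ (K : Set Ω)ᶜ, σ x ∈ (K : Set Ω)ᶜ ∧ σ⁻¹ x ∈ (K : Set Ω)ᶜ := by
    intro x hx
    refine ⟨fun h => hx ?_, fun h => hx ?_⟩
    · have := hfix _ h
      rwa [← σ.injective this]
    · have := hfix' _ h
      rwa [← σ⁻¹.injective this]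
  have hcomp : τ * σ ∈ compatible Ω Λ ξ ↔ σ ∈ compatible Ω Λ ξ := by
    have : ∀ x : Ω, (x : EuclideanSpace ℝ (Fin d)) ∉ Λ → ∀ n : ℤ,
        ((τ * σ) ^ n) x = (σ ^ n) x := by
      intro x hx n
      rw [← hV] at hx
      refine zpow_apply_eq hT (fun y hy => ?_) (x := x) (by simpa using hx) n
      exact hτ _ (by simpa using (hT y hy).1)
    simp only [compatible, Set.mem_ofPred_eq]
    exact forall_congr' fun x => forall_congr' fun hx => forall_congr' fun n => by rw [this x hx n]
  have hw : boltzmannWeight Ω Λ α (τ * σ) = ∏ x ∈ K, jumpWeight α x (τ x) := by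
    rw [boltzmannWeight_eq_prod hV]
    refine Finset.prod_congr rfl fun x hx => ?_
    rw [Equiv.Perm.mul_apply, hfix x hx]
  have hw' : boltzmannWeight Ω Λ α σ = 1 := by
    rw [boltzmannWeight_eq_prod hV]
    refine Finset.prod_eq_one fun x hx => ?_
    rw [hfix x hx, jumpWeight_self]
  simp only [Set.indicator, hcomp, hm, hσ, hw, hw']
  split_ifs
  · simp [div_eq_mul_inv]
  · simp

/-! ### Resampling inside a finite invariant set -/

open Classical in
-- Each `ξ ∈ E` maps the finite set `K` into itself, so it factors uniquely as a permutation of `K`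
-- times one fixing `K`. Quasi-invariance weighs the first factor.
theorem IsQuasiInvariant.restrict_eq_sum {α : ℝ} {μ : Measure (Equiv.Perm Ω)}
    (hμ : IsQuasiInvariant α μ) {K : Finset Ω} {E : Set (Equiv.Perm Ω)} (hE : MeasurableSet E)
    (hK : ∀ ξ ∈ E, ∀ x ∈ K, ξ x ∈ K)
    (hsat : ∀ (τ : Equiv.Perm K) ξ, ξ ∈ E → Equiv.Perm.ofSubtype τ * ξ ∈ E) :
    μ.restrict E = ∑ τ : Equiv.Perm K, permWeight α K τ •
      (μ.restrict (E ∩ fixing K)).map (fun ξ => Equiv.Perm.ofSubtype τ * ξ) := by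
  have hsat' : ∀ (τ : Equiv.Perm K) ξ, (Equiv.Perm.ofSubtype τ)⁻¹ * ξ ∈ E ↔ ξ ∈ E := by
    intro τ ξ
    constructor
    · intro h
      simpa using hsat τ _ h
    · intro h
      simpa using hsat τ⁻¹ _ h
  have hmeas : ∀ τ : Equiv.Perm Ω, Measurable fun ξ => τ * ξ := fun τ =>
    (continuous_const_mul τ).measurable
  ext A hA
  rw [Measure.restrict_apply hA]
  simp only [Measure.coe_finsetSum, Finset.sum_apply, Measure.smul_apply, smul_eq_mul]
  have hterm : ∀ τ : Equiv.Perm K, permWeight α K τ *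
      ((μ.restrict (E ∩ fixing K)).map (fun ξ => Equiv.Perm.ofSubtype τ * ξ)) A =
      μ (A ∩ E ∩ cylinder K (Equiv.Perm.ofSubtype τ)) := by
    intro τ
    have hB : MeasurableSet ((fun ξ => Equiv.Perm.ofSubtype τ * ξ) ⁻¹' A ∩ (E ∩ fixing K)) :=
      (hmeas _ hA).inter (hE.inter (measurableSet_cylinder _ _))
    rw [Measure.map_apply (hmeas _) hA, Measure.restrict_apply (hmeas _ hA),
      ← prod_jumpWeight_ofSubtype, ← hμ K _ (fun x hx => Equiv.Perm.ofSubtype_apply_of_not_mem τ hx)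
        _ hB (fun σ h => h.2.2)]
    congr 1
    ext σ
    simp only [Set.mem_preimage, Set.mem_inter_iff, mul_inv_cancel_left, hsat', and_assoc]
    refine and_congr_right fun _ => and_congr_right fun _ => ?_
    simp only [mem_fixing, cylinder, Set.mem_ofPred_eq, Equiv.Perm.mul_apply]
    refine forall_congr' fun x => forall_congr' fun hx => ?_
    rw [Equiv.Perm.inv_eq_iff_eq]
  simp_rw [hterm]
  rw [← tsum_fintype (L := .unconditional _), ← measure_iUnion]
  · congr 1
    ext σ
    simp only [Set.mem_iUnion, Set.mem_inter_iff, exists_and_left]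
    refine ⟨fun h => ⟨h, ?_⟩, fun h => h.1⟩
    refine ⟨Equiv.Perm.subtypePermOfFintype σ (hK σ h.2), fun x hx => ?_⟩
    rw [Equiv.Perm.ofSubtype_apply_of_mem _ hx]
    rfl
  · intro τ τ' hne
    refine Set.disjoint_left.2 fun σ h h' => hne ?_
    ext x
    have h1 := h.2 x x.2
    have h2 := h'.2 x x.2
    rw [h1, Equiv.Perm.ofSubtype_apply_coe, Equiv.Perm.ofSubtype_apply_coe] at h2
    rw [h2]
  · intro τ
    exact (hA.inter hE).inter (measurableSet_cylinder _ _)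

end SpatialPerm
end

/-! ### Cycles confined to a finite volume; quasi-invariant laws are Gibbs -/

noncomputable section
namespace SpatialPerm
variable {d : ℕ}
variable {Ω : Set (EuclideanSpace ℝ (Fin d))}

/-- The event that `K` is the set of points whose whole cycle stays in `V`. -/
def confinedEvent (V K : Finset Ω) : Set (Equiv.Perm Ω) :=
  {ξ | ∀ x, x ∈ K ↔ ∀ n : ℤ, (ξ ^ n) x ∈ V}

theorem confinedEvent_zpow_mem_iff {V K : Finset Ω} {ξ : Equiv.Perm Ω}
    (hξ : ξ ∈ confinedEvent V K) (x : Ω) (n : ℤ) : (ξ ^ n) x ∈ K ↔ x ∈ K := by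
  have key : ∀ x (n : ℤ), x ∈ K → (ξ ^ n) x ∈ K := by
    intro x n hx
    rw [hξ] at hx ⊢
    intro m
    rw [← Equiv.Perm.mul_apply, ← zpow_add]
    exact hx _
  refine ⟨fun h => ?_, key x n⟩
  have := key _ (-n) h
  rwa [← Equiv.Perm.mul_apply, ← zpow_add, neg_add_cancel, zpow_zero, Equiv.Perm.one_apply] at this

theorem confinedEvent_apply_mem_iff {V K : Finset Ω} {ξ : Equiv.Perm Ω}
    (hξ : ξ ∈ confinedEvent V K) (x : Ω) : ξ x ∈ K ↔ x ∈ K := by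
  simpa using confinedEvent_zpow_mem_iff hξ x 1

theorem confinedEvent_inv_apply_mem_iff {V K : Finset Ω} {ξ : Equiv.Perm Ω}
    (hξ : ξ ∈ confinedEvent V K) (x : Ω) : ξ⁻¹ x ∈ K ↔ x ∈ K := by
  simpa using confinedEvent_zpow_mem_iff hξ x (-1)

theorem confinedEvent_subset {V K : Finset Ω} {ξ : Equiv.Perm Ω}
    (hξ : ξ ∈ confinedEvent V K) : K ⊆ V := fun x hx => by
  simpa using (hξ x).1 hx 0

theorem confinedEvent_compl_invariant {V K : Finset Ω} {ξ : Equiv.Perm Ω}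
    (hξ : ξ ∈ confinedEvent V K) :
    ∀ x ∈ (K : Set Ω)ᶜ, ξ x ∈ (K : Set Ω)ᶜ ∧ ξ⁻¹ x ∈ (K : Set Ω)ᶜ := by
  intro x hx
  simp only [Set.mem_compl_iff, Finset.mem_coe, confinedEvent_apply_mem_iff hξ,
    confinedEvent_inv_apply_mem_iff hξ] at *
  exact ⟨hx, hx⟩

/-- The complement of `K` is `ξ`-invariant, so agreement there extends to all iterates and forces
`σ` to preserve `K`. Resampling inside `K` thus keeps the event. -/
theorem confinedEvent_of_eqOn_compl {V K : Finset Ω} {ξ σ : Equiv.Perm Ω}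
    (hξ : ξ ∈ confinedEvent V K) (hσ : ∀ x ∉ K, σ x = ξ x) : σ ∈ confinedEvent V K := by
  have hc := confinedEvent_compl_invariant hξ
  have hz : ∀ x ∉ K, ∀ n : ℤ, (σ ^ n) x = (ξ ^ n) x := fun x hx n =>
    zpow_apply_eq hc (fun y hy => hσ y (by simpa using hy)) (x := x) (by simpa using hx) n
  have hmap : ∀ x ∈ (K : Set Ω), σ x ∈ (K : Set Ω) ∧ σ⁻¹ x ∈ (K : Set Ω) := by
    intro x hx
    have hx' : x ∈ K := by simpa using hx
    constructor
    · by_contra h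
      have h1 : σ x ∉ K := by simpa using h
      have h2 := hz _ h1 (-1)
      rw [zpow_neg_one, zpow_neg_one, ← Equiv.Perm.mul_apply σ⁻¹, inv_mul_cancel,
        Equiv.Perm.one_apply] at h2
      rw [h2] at hx'
      exact h1 ((confinedEvent_inv_apply_mem_iff hξ _).1 hx')
    · by_contra h
      have h1 : σ⁻¹ x ∉ K := by simpa using h
      have h2 := hσ _ h1
      rw [← Equiv.Perm.mul_apply, mul_inv_cancel, Equiv.Perm.one_apply] at h2
      rw [h2] at hx'
      exact h1 ((confinedEvent_apply_mem_iff hξ _).1 hx')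
  intro x
  by_cases hx : x ∈ K
  · refine iff_of_true hx fun n => confinedEvent_subset hξ ?_
    simpa using zpow_apply_mem hmap (x := x) (by simpa using hx) n
  · simp_rw [hz x hx]
    exact hξ x

/-- A point `x ∉ K` has some `ξ ^ n x` outside `Λ`. Compatibility there with exponents `-n` and `1 -
n` gives `σ x = ξ x`. -/
theorem mem_compatible_iff_of_confined {Λ : Set (EuclideanSpace ℝ (Fin d))} {V K : Finset Ω}
    (hV : ∀ x : Ω, x ∈ V ↔ (x : EuclideanSpace ℝ (Fin d)) ∈ Λ) {ξ : Equiv.Perm Ω}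
    (hξ : ξ ∈ confinedEvent V K) (σ : Equiv.Perm Ω) :
    σ ∈ compatible Ω Λ ξ ↔ ∀ x ∉ K, σ x = ξ x := by
  constructor
  · intro h x hx
    rw [hξ x] at hx
    push Not at hx
    obtain ⟨n, hn⟩ := hx
    rw [hV] at hn
    have h1 := h _ hn (-n)
    have h2 := h _ hn (1 - n)
    rw [sub_eq_add_neg, zpow_add, zpow_add, Equiv.Perm.mul_apply, Equiv.Perm.mul_apply, h1,
      ← Equiv.Perm.mul_apply (ξ ^ (-n)), ← zpow_add, neg_add_cancel] at h2
    simpa using h2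
  · intro h x hx n
    refine zpow_apply_eq (confinedEvent_compl_invariant hξ) (fun y hy => h y (by simpa using hy))
      (x := x) ?_ n
    rw [← hV] at hx
    simpa using fun h' => hx (confinedEvent_subset hξ h')

theorem mem_confinedEvent_unique {V K K' : Finset Ω} {ξ : Equiv.Perm Ω}
    (h : ξ ∈ confinedEvent V K) (h' : ξ ∈ confinedEvent V K') : K = K' := by
  ext x
  rw [h, h']

theorem exists_mem_confinedEvent (V : Finset Ω) (ξ : Equiv.Perm Ω) :
    ∃ K ∈ V.powerset, ξ ∈ confinedEvent V K := by
  classical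
  refine ⟨V.filter fun x => ∀ n : ℤ, (ξ ^ n) x ∈ V, by simp, fun x => ?_⟩
  simp only [Finset.mem_filter, and_iff_right_iff_imp]
  intro h
  simpa using h 0

open Classical in
-- Compatible permutations differ only by a permutation of `K`, and the weight of the jumps from `V
-- \ K` is a common factor that cancels. The specification is therefore the finite Gibbs law on `K`.
theorem specification_of_confined {Λ : Set (EuclideanSpace ℝ (Fin d))} {V K : Finset Ω}
    (hV : ∀ x : Ω, x ∈ V ↔ (x : EuclideanSpace ℝ (Fin d)) ∈ Λ) (α : ℝ) {ξ : Equiv.Perm Ω}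
    (hξ : ξ ∈ confinedEvent V K) (hfix : ξ ∈ fixing K) (τ₀ : Equiv.Perm K)
    {A : Set (Equiv.Perm Ω)} (hA : MeasurableSet A) :
    specification Ω Λ α (Equiv.Perm.ofSubtype τ₀ * ξ) A =
      (∑ τ : Equiv.Perm K, permWeight α K τ * A.indicator 1 (Equiv.Perm.ofSubtype τ * ξ)) /
        ∑ τ, permWeight α K τ := by
  let j : Equiv.Perm K → Equiv.Perm Ω := fun τ => Equiv.Perm.ofSubtype τ * ξ
  have hj : Function.Injective j := fun τ τ' h =>
    Equiv.Perm.ofSubtype_injective (mul_right_cancel h)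
  have hout : ∀ τ, ∀ x ∉ K, j τ x = ξ x := by
    intro τ x hx
    simp only [j, Equiv.Perm.mul_apply]
    rw [Equiv.Perm.ofSubtype_apply_of_not_mem]
    exact fun h => hx ((confinedEvent_apply_mem_iff hξ x).1 h)
  have hξ₀ : j τ₀ ∈ confinedEvent V K := confinedEvent_of_eqOn_compl hξ (hout τ₀)
  have hrange : compatible Ω Λ (j τ₀) = Set.range j := by
    ext σ
    rw [mem_compatible_iff_of_confined hV hξ₀]
    constructor
    · intro h
      have hσ : σ ∈ confinedEvent V K := confinedEvent_of_eqOn_compl hξ₀ h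
      refine ⟨Equiv.Perm.subtypePermOfFintype σ
        (fun x hx => (confinedEvent_apply_mem_iff hσ x).2 hx), ?_⟩
      ext x
      by_cases hx : x ∈ K
      · simp only [j, Equiv.Perm.mul_apply]
        rw [hfix x hx]
        simp only [id]
        rw [Equiv.Perm.ofSubtype_apply_of_mem _ hx]
        rfl
      · rw [hout _ x hx, h x hx, hout _ x hx]
    · rintro ⟨τ, rfl⟩ x hx
      rw [hout _ x hx, hout _ x hx]
  let c : ℝ≥0∞ := ∏ x ∈ V \ K, jumpWeight α x (ξ x)
  have hc0 : c ≠ 0 := Finset.prod_ne_zero_iff.2 fun _ _ => jumpWeight_ne_zero _ _ _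
  have hct : c ≠ ∞ := ENNReal.prod_ne_top fun _ _ => jumpWeight_ne_top _ _ _
  have hbw : ∀ τ, boltzmannWeight Ω Λ α (j τ) = c * permWeight α K τ := by
    intro τ
    rw [boltzmannWeight_eq_prod hV, ← Finset.prod_sdiff (confinedEvent_subset hξ),
      ← prod_jumpWeight_ofSubtype]
    congr 1
    · refine Finset.prod_congr rfl fun x hx => ?_
      rw [hout _ x (Finset.mem_sdiff.1 hx).2]
    · refine Finset.prod_congr rfl fun x hx => ?_
      simp only [j, Equiv.Perm.mul_apply]
      rw [hfix x hx]
      rfl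
  have htsum : ∀ f : Equiv.Perm Ω → ℝ≥0∞,
      ∑' σ, (compatible Ω Λ (j τ₀)).indicator f σ = ∑ τ, f (j τ) := by
    intro f
    rw [← hj.tsum_eq, tsum_fintype]
    · refine Finset.sum_congr rfl fun τ _ => ?_
      rw [Set.indicator_of_mem]
      rw [hrange]; exact ⟨τ, rfl⟩
    · rw [hrange]
      exact Set.support_indicator_subset
  have hZ : partitionFunction Ω Λ α (j τ₀) = c * ∑ τ, permWeight α K τ := by
    rw [partitionFunction, tsum_subtype (compatible Ω Λ (j τ₀)) (boltzmannWeight Ω Λ α), htsum,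
      Finset.mul_sum]
    exact Finset.sum_congr rfl fun τ _ => hbw τ
  change specification Ω Λ α (j τ₀) A = _
  rw [specification_apply _ _ _ hA, htsum, div_eq_mul_inv, Finset.sum_mul]
  refine Finset.sum_congr rfl fun τ _ => ?_
  rw [hbw, hZ, ENNReal.mul_div_mul_left _ _ hc0 hct, div_eq_mul_inv]
  ring

variable [DiscreteTopology Ω]

theorem measurableSet_zpow_mem (V : Finset Ω) (x : Ω) (n : ℤ) :
    MeasurableSet {ξ : Equiv.Perm Ω | (ξ ^ n) x ∈ V} :=
  ((isOpen_discrete (V : Set Ω)).preimage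
    ((continuous_perm_apply x).comp (continuous_zpow n))).measurableSet

theorem measurableSet_confinedEvent [Countable Ω] (V K : Finset Ω) :
    MeasurableSet (confinedEvent V K) := by
  have : confinedEvent V K = ⋂ x : Ω, {ξ | x ∈ K ↔ ∀ n : ℤ, (ξ ^ n) x ∈ V} := by
    ext ξ; simp only [confinedEvent, Set.mem_iInter, Set.mem_ofPred_eq]
  rw [this]
  refine MeasurableSet.iInter fun x => ?_
  have h : MeasurableSet {ξ : Equiv.Perm Ω | ∀ n : ℤ, (ξ ^ n) x ∈ V} := by
    have : {ξ : Equiv.Perm Ω | ∀ n : ℤ, (ξ ^ n) x ∈ V} = ⋂ n : ℤ, {ξ | (ξ ^ n) x ∈ V} := by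
      ext ξ; simp only [Set.mem_iInter, Set.mem_ofPred_eq]
    rw [this]
    exact MeasurableSet.iInter fun n => measurableSet_zpow_mem V x n
  by_cases hx : x ∈ K
  · simpa [hx] using h
  · simp only [hx, false_iff]
    exact h.compl

theorem sum_restrict_confinedEvent [Countable Ω] (V : Finset Ω) (μ : Measure (Equiv.Perm Ω)) :
    ∑ K ∈ V.powerset, μ.restrict (confinedEvent V K) = μ := by
  ext A hA
  simp only [Measure.coe_finsetSum, Finset.sum_apply, Measure.restrict_apply hA]
  rw [← measure_biUnion_finset]
  · congr 1
    ext ξ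
    simp only [Set.mem_iUnion, Set.mem_inter_iff, exists_and_left, exists_prop]
    refine ⟨fun h => h.1, fun h => ?_⟩
    · obtain ⟨K, h1, h2⟩ := exists_mem_confinedEvent V ξ
      exact ⟨h, K, h1, h2⟩
  · intro K _ K' _ hne
    exact Set.disjoint_left.2 fun ξ h h' => hne (mem_confinedEvent_unique h.2 h'.2)
  · intro K _
    exact hA.inter (measurableSet_confinedEvent V K)

open Classical in
theorem IsQuasiInvariant.restrict_confinedEvent [Countable Ω] {α : ℝ}
    {μ : Measure (Equiv.Perm Ω)} (hμ : IsQuasiInvariant α μ) (V K : Finset Ω) :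
    μ.restrict (confinedEvent V K) = ∑ τ : Equiv.Perm K, permWeight α K τ •
      (μ.restrict (confinedEvent V K ∩ fixing K)).map (fun ξ => Equiv.Perm.ofSubtype τ * ξ) := by
  refine hμ.restrict_eq_sum (measurableSet_confinedEvent V K)
    (fun ξ hξ x hx => (confinedEvent_apply_mem_iff hξ x).2 hx) fun τ ξ hξ => ?_
  refine confinedEvent_of_eqOn_compl hξ fun x hx => ?_
  rw [Equiv.Perm.mul_apply, Equiv.Perm.ofSubtype_apply_of_not_mem]
  exact fun h => hx ((confinedEvent_apply_mem_iff hξ x).1 h)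

/-- Split `μ` by the set `K` of points whose cycles stay in the volume. On each piece `μ` already
has the Gibbs law inside `K`, and the specification resamples exactly that law. -/
theorem IsQuasiInvariant.isGibbs [Countable Ω]
    (hΩ : ∀ K : Set (EuclideanSpace ℝ (Fin d)), IsCompact K → (Ω ∩ K).Finite) {α : ℝ}
    {μ : Measure (Equiv.Perm Ω)} [IsProbabilityMeasure μ] (hμ : IsQuasiInvariant α μ) :
    IsGibbs Ω α μ := by
  classical
  refine ⟨inferInstance, fun Λ hΛ A hA => ?_⟩
  have hfin : {x : Ω | (x : EuclideanSpace ℝ (Fin d)) ∈ Λ}.Finite := by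
    refine Set.Finite.of_finite_image ((hΩ Λ hΛ).subset ?_) Subtype.val_injective.injOn
    rintro _ ⟨x, hx, rfl⟩
    exact ⟨x.2, hx⟩
  let V : Finset Ω := hfin.toFinset
  have hV : ∀ x : Ω, x ∈ V ↔ (x : EuclideanSpace ℝ (Fin d)) ∈ Λ := by simp [V]
  conv_lhs => rw [← sum_restrict_confinedEvent V μ]
  conv_rhs => rw [← sum_restrict_confinedEvent V μ]
  rw [lintegral_finsetSum_measure]
  simp only [Measure.coe_finsetSum, Finset.sum_apply]
  refine Finset.sum_congr rfl fun K _ => ?_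
  rw [hμ.restrict_confinedEvent V K, lintegral_finsetSum_measure]
  simp only [Measure.coe_finsetSum, Finset.sum_apply, Measure.smul_apply, smul_eq_mul,
    lintegral_smul_measure]
  have hmeas : ∀ τ : Equiv.Perm Ω, Measurable fun ξ => τ * ξ := fun τ =>
    (continuous_const_mul τ).measurable
  set ν := μ.restrict (confinedEvent V K ∩ fixing K) with hν
  have hE : MeasurableSet (confinedEvent V K ∩ fixing K) :=
    (measurableSet_confinedEvent V K).inter (measurableSet_cylinder _ _)
  have h1 : ∀ τ₀ : Equiv.Perm K, ∫⁻ ξ, specification Ω Λ α ξ A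
      ∂(ν.map fun ξ => Equiv.Perm.ofSubtype τ₀ * ξ) =
      (∑ τ : Equiv.Perm K, permWeight α K τ *
        ν.map (fun ξ => Equiv.Perm.ofSubtype τ * ξ) A) / ∑ τ, permWeight α K τ := by
    intro τ₀
    have he := lintegral_map_equiv (μ := ν) (fun ξ => specification Ω Λ α ξ A)
      (Homeomorph.mulLeft (Equiv.Perm.ofSubtype τ₀)).toMeasurableEquiv
    change ∫⁻ ξ, specification Ω Λ α ξ A ∂(ν.map fun ξ => Equiv.Perm.ofSubtype τ₀ * ξ) =
      ∫⁻ ξ, specification Ω Λ α (Equiv.Perm.ofSubtype τ₀ * ξ) A ∂ν at he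
    rw [he, hν, setLIntegral_congr_fun hE fun ξ hξ =>
      specification_of_confined hV α hξ.1 hξ.2 τ₀ hA, ← hν]
    simp_rw [div_eq_mul_inv]
    rw [lintegral_mul_const', lintegral_finsetSum']
    · congr 1
      refine Finset.sum_congr rfl fun τ _ => ?_
      rw [lintegral_const_mul' _ _ (permWeight_ne_top _ _ _), Measure.map_apply (hmeas _) hA,
        ← lintegral_indicator_one (hmeas _ hA)]
      rfl
    · intro τ _
      exact ((measurable_const.indicator (hmeas _ hA)).const_mul _).aemeasurable
    · exact ENNReal.inv_ne_top.2 (sum_permWeight_ne_zero α K)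
  -- The right side of `h1` does not depend on `τ₀`, so summing its weights cancels the
  -- normalisation.
  simp_rw [h1]
  rw [← Finset.sum_mul, ENNReal.mul_div_cancel (sum_permWeight_ne_zero α K)
    (sum_permWeight_ne_top α K)]

/-- Under a quasi-invariant law of finite cycle permutations, prescribing finitely many jumps has
probability at most the product of their weights. -/
theorem IsQuasiInvariant.measure_jumps_le [Countable Ω] {α : ℝ} (hα : 0 ≤ α)
    {μ : Measure (Equiv.Perm Ω)} [IsProbabilityMeasure μ] (hμ : IsQuasiInvariant α μ)
    (hfc : ∀ᵐ σ ∂μ, IsFiniteCyclePerm σ) {s : Type*} [Fintype s] (u v : s → Ω)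
    (hu : Function.Injective u) :
    μ {σ | ∀ i, σ (u i) = v i} ≤ ∏ i, jumpWeight α (u i) (v i) := by
  classical
  let C : Set (Equiv.Perm Ω) := {σ | ∀ i, σ (u i) = v i}
  have hC : MeasurableSet C := by
    have : C = ⋂ i, {σ : Equiv.Perm Ω | σ (u i) = v i} := by
      ext; simp [C]
    rw [this]
    exact MeasurableSet.iInter fun i => (isOpen_perm_apply_eq _ _).measurableSet
  -- On `D V` the cycles of all `u i` stay in `V`, so the `u i` and their images lie in the confined
  -- set `K`, where the finite bound applies. Finiteness of cycles makes the `D V` exhaust `C` up to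
  -- a null set.
  let D : Finset Ω → Set (Equiv.Perm Ω) := fun V => {σ | ∀ i, ∀ n : ℤ, (σ ^ n) (u i) ∈ V}
  have hmeas : ∀ τ : Equiv.Perm Ω, Measurable fun ξ => τ * ξ := fun τ =>
    (continuous_const_mul τ).measurable
  have hcell : ∀ V K : Finset Ω, μ.restrict (confinedEvent V K) (C ∩ D V) ≤
      (∏ i, jumpWeight α (u i) (v i)) * μ (confinedEvent V K) := by
    intro V K
    by_cases hK : (∀ i, u i ∈ K) ∧ ∀ i, v i ∈ K
    · refine (measure_mono Set.inter_subset_left).trans ?_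
      have h0 : μ (confinedEvent V K) = μ.restrict (confinedEvent V K) Set.univ := by simp
      rw [h0, hμ.restrict_confinedEvent V K]
      simp only [Measure.coe_finsetSum, Finset.sum_apply, Measure.smul_apply, smul_eq_mul]
      set ν := μ.restrict (confinedEvent V K ∩ fixing K) with hν
      have h1 : ∀ τ : Equiv.Perm K, ν.map (fun ξ => Equiv.Perm.ofSubtype τ * ξ) C =
          if ∀ i, τ ⟨u i, hK.1 i⟩ = ⟨v i, hK.2 i⟩ then ν Set.univ else 0 := by
        intro τ
        have hE : MeasurableSet (confinedEvent V K ∩ fixing K) :=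
          (measurableSet_confinedEvent V K).inter (measurableSet_cylinder _ _)
        rw [Measure.map_apply (hmeas _) hC, hν, Measure.restrict_apply (hmeas _ hC),
          Measure.restrict_apply MeasurableSet.univ, Set.univ_inter]
        have h2 : ∀ ξ ∈ confinedEvent V K ∩ fixing K, Equiv.Perm.ofSubtype τ * ξ ∈ C ↔
            ∀ i, τ ⟨u i, hK.1 i⟩ = ⟨v i, hK.2 i⟩ := by
          intro ξ hξ
          refine forall_congr' fun i => ?_
          rw [Equiv.Perm.mul_apply, mem_fixing.1 hξ.2 _ (hK.1 i),
            Equiv.Perm.ofSubtype_apply_of_mem _ (hK.1 i)]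
          exact ⟨fun h => Subtype.ext h, fun h => congrArg Subtype.val h⟩
        split_ifs with h
        · congr 1
          ext ξ
          simp only [Set.mem_inter_iff, Set.mem_preimage]
          exact ⟨fun h => h.2, fun h' => ⟨(h2 ξ h').2 h, h'⟩⟩
        · refine measure_mono_null (t := ∅) (fun ξ hξ => ?_) measure_empty
          exact h ((h2 ξ hξ.2).1 hξ.1)
      have h3 : ∀ τ : Equiv.Perm K, ν.map (fun ξ => Equiv.Perm.ofSubtype τ * ξ) Set.univ =
          ν Set.univ := by
        intro τ
        rw [Measure.map_apply (hmeas _) MeasurableSet.univ, Set.preimage_univ]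
      simp_rw [h1, h3]
      rw [← Finset.sum_mul, ← mul_assoc]
      simp only [mul_ite, mul_zero]
      rw [← Finset.sum_filter, ← Finset.sum_mul]
      gcongr
      exact sum_permWeight_constrained_le hα K (fun i => ⟨u i, hK.1 i⟩) (fun i => ⟨v i, hK.2 i⟩)
        fun i j h => hu (Subtype.ext_iff.1 h)
    · rw [Measure.restrict_apply' (measurableSet_confinedEvent V K)]
      refine le_of_eq_of_le (measure_mono_null (t := ∅) ?_ measure_empty) zero_le
      rintro ξ ⟨⟨hξC, hξD⟩, hξ⟩
      refine hK ⟨fun i => (hξ _).2 (hξD i), fun i => ?_⟩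
      rw [← hξC i, confinedEvent_apply_mem_iff hξ]
      exact (hξ _).2 (hξD i)
  have hV : ∀ V : Finset Ω, μ (C ∩ D V) ≤ ∏ i, jumpWeight α (u i) (v i) := by
    intro V
    calc μ (C ∩ D V) = ∑ K ∈ V.powerset, μ.restrict (confinedEvent V K) (C ∩ D V) := by
          conv_lhs => rw [← sum_restrict_confinedEvent V μ]
          simp only [Measure.coe_finsetSum, Finset.sum_apply]
      _ ≤ ∑ K ∈ V.powerset, (∏ i, jumpWeight α (u i) (v i)) * μ (confinedEvent V K) :=
          Finset.sum_le_sum fun K _ => hcell V K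
      _ = (∏ i, jumpWeight α (u i) (v i)) * μ Set.univ := by
          rw [← Finset.mul_sum]
          congr 1
          conv_rhs => rw [← sum_restrict_confinedEvent V μ]
          simp
      _ = _ := by simp
  have hmono : Monotone fun V => C ∩ D V := fun V V' h =>
    Set.inter_subset_inter_right _ fun σ hσ i n => h (hσ i n)
  calc μ C ≤ μ (⋃ V, C ∩ D V) := by
        refine measure_mono_ae ?_
        filter_upwards [hfc] with σ hσ hσC
        refine Set.mem_iUnion.2 ⟨Finset.univ.biUnion fun i => (hσ (u i)).toFinset, hσC, ?_⟩
        intro i n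
        simp only [Finset.mem_biUnion, Finset.mem_univ, true_and, Set.Finite.mem_toFinset]
        exact ⟨i, n, rfl⟩
    _ = ⨆ V, μ (C ∩ D V) := hmono.directed_le.measure_iUnion
    _ ≤ _ := iSup_le hV

end SpatialPerm
end

noncomputable section
namespace SpatialPerm
variable {d : ℕ}
variable {Ω : Set (EuclideanSpace ℝ (Fin d))}

/-! ### Self-avoiding paths -/

/-- The weight of a self-avoiding path. -/
def pathWeight (α : ℝ) {n : ℕ} (p : Fin (n + 1) ↪ Ω) : ℝ≥0∞ :=
  ∏ i : Fin n, jumpWeight α (p i.castSucc) (p i.succ)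

/-- The total weight of the self-avoiding paths with `n` jumps that start at `x`. -/
def pathSum (α : ℝ) (x : Ω) (n : ℕ) : ℝ≥0∞ :=
  ∑' p : {p : Fin (n + 1) ↪ Ω // p 0 = x}, pathWeight α p.1

/-- The generating function of self-avoiding paths is finite at `2`. -/
def IsSubcritical (α : ℝ) (Ω : Set (EuclideanSpace ℝ (Fin d))) : Prop :=
  ∀ x : Ω, ∑' n, 2 ^ n * pathSum α x n ≠ ∞

theorem IsSubcritical.tendsto {α : ℝ} (h : IsSubcritical α Ω) (x : Ω) :
    Filter.Tendsto (fun n => 2 ^ n * pathSum α x n) Filter.atTop (nhds 0) :=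
  ENNReal.tendsto_atTop_zero_of_tsum_ne_top (h x)

/-! ### Points reachable by two permutations -/

open Classical in
/-- The points reachable from `S` by at most `n` applications of `σ` or `σ'`. -/
def reach (σ σ' : Equiv.Perm Ω) (S : Finset Ω) : ℕ → Finset Ω
  | 0 => S
  | n + 1 => reach σ σ' S n ∪ ((reach σ σ' S n).image σ ∪ (reach σ σ' S n).image σ')

theorem mem_reach_succ {σ σ' : Equiv.Perm Ω} {S : Finset Ω} {n : ℕ} {y : Ω} :
    y ∈ reach σ σ' S (n + 1) ↔ y ∈ reach σ σ' S n ∨ ∃ z ∈ reach σ σ' S n, y = σ z ∨ y = σ' z := by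
  classical
  simp only [reach, Finset.mem_union, Finset.mem_image]
  constructor
  · rintro (h | ⟨z, h, rfl⟩ | ⟨z, h, rfl⟩)
    · exact Or.inl h
    · exact Or.inr ⟨z, h, Or.inl rfl⟩
    · exact Or.inr ⟨z, h, Or.inr rfl⟩
  · rintro (h | ⟨z, h, rfl | rfl⟩)
    · exact Or.inl h
    · exact Or.inr (Or.inl ⟨z, h, rfl⟩)
    · exact Or.inr (Or.inr ⟨z, h, rfl⟩)

theorem reach_mono (σ σ' : Equiv.Perm Ω) (S : Finset Ω) : Monotone (reach σ σ' S) :=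
  monotone_nat_of_le_succ fun _ _ hy => mem_reach_succ.2 (Or.inl hy)

theorem reach_comm (σ σ' : Equiv.Perm Ω) (S : Finset Ω) (n : ℕ) :
    reach σ σ' S n = reach σ' σ S n := by
  induction n with
  | zero => rfl
  | succ n ih =>
    ext y
    rw [mem_reach_succ, mem_reach_succ, ih]
    simp only [or_comm]

theorem reach_congr {σ σ' η η' : Equiv.Perm Ω} {S K : Finset Ω}
    (hK : ∀ n, reach σ σ' S n ⊆ K) (h : ∀ x ∈ K, η x = σ x) (h' : ∀ x ∈ K, η' x = σ' x) (n : ℕ) :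
    reach η η' S n = reach σ σ' S n := by
  induction n with
  | zero => rfl
  | succ n ih =>
    ext y
    rw [mem_reach_succ, mem_reach_succ, ih]
    refine or_congr_right (exists_congr fun z => and_congr_right fun hz => ?_)
    rw [h z (hK n hz), h' z (hK n hz)]

theorem reach_eq_of_stable {σ σ' : Equiv.Perm Ω} {S : Finset Ω} {n : ℕ}
    (h : reach σ σ' S n = reach σ σ' S (n + 1)) {m : ℕ} (hm : n ≤ m) :
    reach σ σ' S m = reach σ σ' S n := by
  induction m, hm using Nat.le_induction with
  | base => rfl
  | succ m _ ih =>
    rw [h]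
    ext y
    rw [mem_reach_succ, mem_reach_succ, ih]

/-- A predecessor of a point first reached at time `n + 1` is itself first reached at time `n`.
Recording the first times makes the path self-avoiding. -/
theorem exists_path_of_mem_reach {σ σ' : Equiv.Perm Ω} {S : Finset Ω} (n : ℕ) {y : Ω}
    (hy : y ∈ reach σ σ' S n) (hy' : ∀ m < n, y ∉ reach σ σ' S m) :
    ∃ p : Fin (n + 1) → Ω, p 0 ∈ S ∧ p (Fin.last n) = y ∧
      (∀ i : Fin n, p i.succ = σ (p i.castSucc) ∨ p i.succ = σ' (p i.castSucc)) ∧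
      ∀ i : Fin (n + 1), p i ∈ reach σ σ' S i ∧ ∀ m < (i : ℕ), p i ∉ reach σ σ' S m := by
  induction n generalizing y with
  | zero =>
    refine ⟨fun _ => y, hy, rfl, fun i => i.elim0, fun i => ?_⟩
    have : (i : ℕ) = 0 := by omega
    rw [this]
    exact ⟨hy, fun m hm => absurd hm (by omega)⟩
  | succ n ih =>
    rcases mem_reach_succ.1 hy with h | ⟨z, hz, hyz⟩
    · exact absurd h (hy' n (by omega))
    · have hz' : ∀ m < n, z ∉ reach σ σ' S m := fun m hm h =>
        hy' (m + 1) (by omega) (mem_reach_succ.2 (Or.inr ⟨z, h, hyz⟩))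
      obtain ⟨p, hp0, hpl, hps, hpr⟩ := ih hz hz'
      refine ⟨Fin.snoc p y, ?_, by simp, fun i => ?_, fun i => ?_⟩
      · have : (0 : Fin (n + 2)) = Fin.castSucc 0 := rfl
        rw [this, Fin.snoc_castSucc]
        exact hp0
      · refine Fin.lastCases ?_ (fun i => ?_) i
        · rw [Fin.succ_last, Fin.snoc_last, Fin.snoc_castSucc, hpl]
          exact hyz
        · rw [Fin.succ_castSucc, Fin.snoc_castSucc, Fin.snoc_castSucc]
          exact hps i
      · refine Fin.lastCases ?_ (fun i => ?_) i
        · rw [Fin.snoc_last]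
          exact ⟨hy, hy'⟩
        · rw [Fin.snoc_castSucc]
          exact hpr i

theorem exists_embedding_of_not_stable {σ σ' : Equiv.Perm Ω} {S : Finset Ω} {n : ℕ}
    (h : reach σ σ' S n ≠ reach σ σ' S (n + 1)) :
    ∃ p : Fin (n + 1 + 1) ↪ Ω, p 0 ∈ S ∧
      ∀ i : Fin (n + 1), p i.succ = σ (p i.castSucc) ∨ p i.succ = σ' (p i.castSucc) := by
  obtain ⟨y, hy, hy'⟩ : ∃ y ∈ reach σ σ' S (n + 1), y ∉ reach σ σ' S n := by
    by_contra! hc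
    exact h (Finset.Subset.antisymm (reach_mono σ σ' S (Nat.le_succ n)) hc)
  obtain ⟨p, hp0, -, hps, hpr⟩ := exists_path_of_mem_reach (n + 1) hy fun m hm hm' =>
    hy' (reach_mono σ σ' S (by omega) hm')
  have key : ∀ i j : Fin (n + 2), i < j → p i ≠ p j := fun i j hij he =>
    (hpr j).2 i hij (he ▸ (hpr i).1)
  refine ⟨⟨p, fun i j he => ?_⟩, hp0, hps⟩
  rcases lt_trichotomy i j with hij | hij | hij
  · exact absurd he (key i j hij)
  · exact hij
  · exact absurd he.symm (key j i hij)

/-- The event that the set of points reachable from `S` is the finite set `K`. -/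
def reachEvent (S K : Finset Ω) : Set (Equiv.Perm Ω × Equiv.Perm Ω) :=
  {q | ∃ N, ∀ m ≥ N, reach q.1 q.2 S m = K}

theorem reachEvent_subset {S K : Finset Ω} {q : Equiv.Perm Ω × Equiv.Perm Ω}
    (hq : q ∈ reachEvent S K) (n : ℕ) : reach q.1 q.2 S n ⊆ K := by
  obtain ⟨N, hN⟩ := hq
  rw [← hN (max n N) (le_max_right _ _)]
  exact reach_mono _ _ _ (le_max_left _ _)

theorem reachEvent_congr {S K : Finset Ω} {q r : Equiv.Perm Ω × Equiv.Perm Ω}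
    (hq : q ∈ reachEvent S K) (h : ∀ x ∈ K, r.1 x = q.1 x) (h' : ∀ x ∈ K, r.2 x = q.2 x) :
    r ∈ reachEvent S K := by
  obtain ⟨N, hN⟩ := hq
  exact ⟨N, fun m hm => by rw [reach_congr (reachEvent_subset ⟨N, hN⟩) h h', hN m hm]⟩

theorem reachEvent_mapsTo {S K : Finset Ω} {q : Equiv.Perm Ω × Equiv.Perm Ω}
    (hq : q ∈ reachEvent S K) : ∀ x ∈ K, q.1 x ∈ K ∧ q.2 x ∈ K := by
  obtain ⟨N, hN⟩ := hq
  intro x hx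
  rw [← hN N le_rfl] at hx
  rw [← hN (N + 1) (by omega)]
  exact ⟨mem_reach_succ.2 (Or.inr ⟨x, hx, Or.inl rfl⟩),
    mem_reach_succ.2 (Or.inr ⟨x, hx, Or.inr rfl⟩)⟩

theorem reachEvent_swap {S K : Finset Ω} {q : Equiv.Perm Ω × Equiv.Perm Ω} :
    q.swap ∈ reachEvent S K ↔ q ∈ reachEvent S K := by
  simp only [reachEvent, Set.mem_ofPred_eq, Prod.fst_swap, Prod.snd_swap]
  simp_rw [reach_comm q.2 q.1]

theorem reachEvent_disjoint {S : Finset Ω} :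
    Pairwise (Function.onFun Disjoint (reachEvent (Ω := Ω) S)) := by
  intro K K' hne
  refine Set.disjoint_left.2 ?_
  rintro q ⟨N, hN⟩ ⟨N', hN'⟩
  exact hne (by rw [← hN (max N N') (le_max_left _ _), hN' _ (le_max_right _ _)])

open Classical in
-- Such an event is determined by the restrictions to `K`, which are two permutations of `K`; there
-- are finitely many pairs.
theorem eq_iUnion_cylinder_prod {K : Finset Ω} {T : Set (Equiv.Perm Ω × Equiv.Perm Ω)}
    (hT : ∀ q ∈ T, ∀ x ∈ K, q.1 x ∈ K ∧ q.2 x ∈ K)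
    (hT' : ∀ q ∈ T, ∀ r : Equiv.Perm Ω × Equiv.Perm Ω, (∀ x ∈ K, r.1 x = q.1 x) →
      (∀ x ∈ K, r.2 x = q.2 x) → r ∈ T) :
    T = ⋃ t : Equiv.Perm K × Equiv.Perm K,
      if (Equiv.Perm.ofSubtype t.1, Equiv.Perm.ofSubtype t.2) ∈ T then
        cylinder K (Equiv.Perm.ofSubtype t.1) ×ˢ cylinder K (Equiv.Perm.ofSubtype t.2) else ∅ := by
  ext q
  simp only [Set.mem_iUnion]
  constructor
  · intro hq
    let τ : Equiv.Perm K := Equiv.Perm.subtypePermOfFintype q.1 fun x hx => (hT q hq x hx).1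
    let τ' : Equiv.Perm K := Equiv.Perm.subtypePermOfFintype q.2 fun x hx => (hT q hq x hx).2
    have h1 : ∀ x ∈ K, Equiv.Perm.ofSubtype τ x = q.1 x := fun x hx => by
      rw [Equiv.Perm.ofSubtype_apply_of_mem _ hx]; rfl
    have h2 : ∀ x ∈ K, Equiv.Perm.ofSubtype τ' x = q.2 x := fun x hx => by
      rw [Equiv.Perm.ofSubtype_apply_of_mem _ hx]; rfl
    refine ⟨(τ, τ'), ?_⟩
    rw [if_pos (hT' q hq _ h1 h2)]
    exact ⟨fun x hx => (h1 x hx).symm, fun x hx => (h2 x hx).symm⟩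
  · rintro ⟨t, ht⟩
    split_ifs at ht with h
    · exact hT' _ h q (fun x hx => ht.1 x hx) (fun x hx => ht.2 x hx)
    · exact absurd ht (Set.notMem_empty q)

instance (K : Finset Ω) : Fintype (Equiv.Perm K × Equiv.Perm K) :=
  instFintypeProd _ _

instance [Countable Ω] (n : ℕ) : Countable (Fin n ↪ Ω) :=
  (DFunLike.coe_injective (F := Fin n ↪ Ω)).countable

/-! ### Uniqueness by comparing two independent samples -/

section Discrete

variable [DiscreteTopology Ω]

open Classical in
theorem IsQuasiInvariant.measure_cylinder_ofSubtype {α : ℝ} {μ : Measure (Equiv.Perm Ω)}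
    (hμ : IsQuasiInvariant α μ) (K : Finset Ω) (τ : Equiv.Perm K) :
    μ (cylinder K (Equiv.Perm.ofSubtype τ)) = permWeight α K τ * μ (fixing K) := by
  rw [← prod_jumpWeight_ofSubtype, ← hμ K _ (fun x hx => Equiv.Perm.ofSubtype_apply_of_not_mem τ hx)
    (fixing K) (measurableSet_cylinder _ _) subset_rfl]
  congr 1
  ext σ
  simp only [Set.mem_preimage, mem_fixing, cylinder, Set.mem_ofPred_eq, Equiv.Perm.mul_apply]
  refine forall_congr' fun x => forall_congr' fun hx => ?_
  rw [Equiv.Perm.inv_eq_iff_eq]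

open Classical in
theorem measurableSet_of_locallyDetermined [Countable Ω] {K : Finset Ω}
    {T : Set (Equiv.Perm Ω × Equiv.Perm Ω)}
    (hT : ∀ q ∈ T, ∀ x ∈ K, q.1 x ∈ K ∧ q.2 x ∈ K)
    (hT' : ∀ q ∈ T, ∀ r : Equiv.Perm Ω × Equiv.Perm Ω, (∀ x ∈ K, r.1 x = q.1 x) →
      (∀ x ∈ K, r.2 x = q.2 x) → r ∈ T) : MeasurableSet T := by
  rw [eq_iUnion_cylinder_prod hT hT']
  refine MeasurableSet.iUnion fun t => ?_
  split_ifs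
  · exact (measurableSet_cylinder _ _).prod (measurableSet_cylinder _ _)
  · exact MeasurableSet.empty

open Classical in
-- The weight in each term is symmetric in the two permutations of `K` even when `μ` and `μ'`
-- differ: the laws enter only through a common constant.
theorem IsQuasiInvariant.prod_apply_eq_sum [Countable Ω] {α : ℝ}
    {μ μ' : Measure (Equiv.Perm Ω)} [IsProbabilityMeasure μ] [IsProbabilityMeasure μ']
    (hμ : IsQuasiInvariant α μ) (hμ' : IsQuasiInvariant α μ') {K : Finset Ω}
    {T : Set (Equiv.Perm Ω × Equiv.Perm Ω)}
    (hT : ∀ q ∈ T, ∀ x ∈ K, q.1 x ∈ K ∧ q.2 x ∈ K)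
    (hT' : ∀ q ∈ T, ∀ r : Equiv.Perm Ω × Equiv.Perm Ω, (∀ x ∈ K, r.1 x = q.1 x) →
      (∀ x ∈ K, r.2 x = q.2 x) → r ∈ T) :
    (μ.prod μ') T = ∑ t : Equiv.Perm K × Equiv.Perm K,
      if (Equiv.Perm.ofSubtype t.1, Equiv.Perm.ofSubtype t.2) ∈ T then
        permWeight α K t.1 * permWeight α K t.2 * (μ (fixing K) * μ' (fixing K)) else 0 := by
  conv_lhs => rw [eq_iUnion_cylinder_prod hT hT']
  rw [measure_iUnion, tsum_fintype]
  · refine Finset.sum_congr rfl fun t _ => ?_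
    split_ifs
    · rw [Measure.prod_prod, hμ.measure_cylinder_ofSubtype, hμ'.measure_cylinder_ofSubtype]
      ring
    · exact measure_empty
  · intro t t' hne
    refine Set.disjoint_left.2 fun q h h' => hne ?_
    beta_reduce at h h'
    split_ifs at h h'
    · refine Prod.ext (Equiv.ext fun x => Subtype.ext ?_) (Equiv.ext fun x => Subtype.ext ?_)
      · have h1 := h.1 x x.2
        have h2 := h'.1 x x.2
        rwa [h1, Equiv.Perm.ofSubtype_apply_coe, Equiv.Perm.ofSubtype_apply_coe] at h2
      · have h1 := h.2 x x.2
        have h2 := h'.2 x x.2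
        rwa [h1, Equiv.Perm.ofSubtype_apply_coe, Equiv.Perm.ofSubtype_apply_coe] at h2
    all_goals first | exact absurd h (Set.notMem_empty q) | exact absurd h' (Set.notMem_empty q)
  · intro t
    split_ifs
    · exact (measurableSet_cylinder _ _).prod (measurableSet_cylinder _ _)
    · exact MeasurableSet.empty

/-- Choose the set `l` of steps made by the first sample. By independence the two jump bounds
multiply to the path weight, for each of the `2 ^ n` choices. -/
theorem measure_prod_path_le [Countable Ω] {α : ℝ} (hα : 0 ≤ α)
    {μ μ' : Measure (Equiv.Perm Ω)} [IsProbabilityMeasure μ] [IsProbabilityMeasure μ']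
    (hμ : IsQuasiInvariant α μ) (hμ' : IsQuasiInvariant α μ')
    (hfc : ∀ᵐ σ ∂μ, IsFiniteCyclePerm σ) (hfc' : ∀ᵐ σ ∂μ', IsFiniteCyclePerm σ)
    {n : ℕ} (p : Fin (n + 1) ↪ Ω) :
    (μ.prod μ') {q | ∀ i : Fin n, p i.succ = q.1 (p i.castSucc) ∨ p i.succ = q.2 (p i.castSucc)} ≤
      2 ^ n * pathWeight α p := by
  classical
  have hsub : {q : Equiv.Perm Ω × Equiv.Perm Ω | ∀ i : Fin n, p i.succ = q.1 (p i.castSucc) ∨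
      p i.succ = q.2 (p i.castSucc)} ⊆ ⋃ l : Finset (Fin n),
      {σ : Equiv.Perm Ω | ∀ i : {i // i ∈ l}, σ (p i.1.castSucc) = p i.1.succ} ×ˢ
      {σ : Equiv.Perm Ω | ∀ i : {i // i ∉ l}, σ (p i.1.castSucc) = p i.1.succ} := by
    intro q hq
    refine Set.mem_iUnion.2 ⟨Finset.univ.filter fun i => q.1 (p i.castSucc) = p i.succ,
      fun i => ?_, fun i => ?_⟩
    · exact (Finset.mem_filter.1 i.2).2
    · have hi := i.2
      simp only [Finset.mem_filter, Finset.mem_univ, true_and] at hi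
      rcases hq i.1 with h | h
      · exact absurd h.symm hi
      · exact h.symm
  refine (measure_mono hsub).trans ((measure_iUnion_fintype_le _ _).trans ?_)
  have hinj : Function.Injective fun i : Fin n => p i.castSucc := fun i j h =>
    Fin.castSucc_injective n (p.injective h)
  calc _ ≤ ∑ l : Finset (Fin n), pathWeight α p := by
        refine Finset.sum_le_sum fun l _ => ?_
        rw [Measure.prod_prod]
        have h1 := hμ.measure_jumps_le hα hfc (fun i : {i // i ∈ l} => p i.1.castSucc)
          (fun i => p i.1.succ) (fun i j h => Subtype.ext (hinj h))
        have h2 := hμ'.measure_jumps_le hα hfc' (fun i : {i // i ∉ l} => p i.1.castSucc)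
          (fun i => p i.1.succ) (fun i j h => Subtype.ext (hinj h))
        refine (mul_le_mul' h1 h2).trans (le_of_eq ?_)
        rw [pathWeight, ← Fintype.prod_subtype_mul_prod_subtype (fun i => i ∈ l)]
        congr!
    _ = 2 ^ n * pathWeight α p := by simp

/-- If the reachable set never stabilises, there are self-avoiding paths from `S` of every positive
length, and the union bound over them tends to `0`. -/
theorem ae_exists_reachEvent [Countable Ω] {α : ℝ} (hα : 0 ≤ α) (hΩ : IsSubcritical α Ω)
    {μ μ' : Measure (Equiv.Perm Ω)} [IsProbabilityMeasure μ] [IsProbabilityMeasure μ']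
    (hμ : IsQuasiInvariant α μ) (hμ' : IsQuasiInvariant α μ')
    (hfc : ∀ᵐ σ ∂μ, IsFiniteCyclePerm σ) (hfc' : ∀ᵐ σ ∂μ', IsFiniteCyclePerm σ) (S : Finset Ω) :
    ∀ᵐ q ∂(μ.prod μ'), ∃ K, q ∈ reachEvent S K := by
  have hbound : ∀ n, (μ.prod μ') {q | ¬∃ K, q ∈ reachEvent S K} ≤
      ∑ x ∈ S, 2 ^ (n + 1) * pathSum α x (n + 1) := by
    intro n
    have hsub : {q : Equiv.Perm Ω × Equiv.Perm Ω | ¬∃ K, q ∈ reachEvent S K} ⊆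
        ⋃ x ∈ S, ⋃ p : {p : Fin (n + 1 + 1) ↪ Ω // p 0 = x}, {q | ∀ i : Fin (n + 1),
          p.1 i.succ = q.1 (p.1 i.castSucc) ∨ p.1 i.succ = q.2 (p.1 i.castSucc)} := by
      intro q hq
      have hne : reach q.1 q.2 S n ≠ reach q.1 q.2 S (n + 1) := fun h =>
        hq ⟨_, n, fun m hm => reach_eq_of_stable h hm⟩
      obtain ⟨p, hp0, hp⟩ := exists_embedding_of_not_stable hne
      simp only [Set.mem_iUnion]
      exact ⟨p 0, hp0, ⟨p, rfl⟩, hp⟩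
    refine (measure_mono hsub).trans ((measure_biUnion_finset_le _ _).trans ?_)
    refine Finset.sum_le_sum fun x _ => ?_
    refine (measure_iUnion_le _).trans ?_
    rw [pathSum, ← ENNReal.tsum_mul_left]
    exact ENNReal.tsum_le_tsum fun p => measure_prod_path_le hα hμ hμ' hfc hfc' p.1
  have hlim : Filter.Tendsto (fun n => ∑ x ∈ S, 2 ^ (n + 1) * pathSum α x (n + 1)) Filter.atTop
      (nhds 0) := by
    have h := tendsto_finsetSum S fun x _ => (hΩ.tendsto x).comp (Filter.tendsto_add_atTop_nat 1)
    rwa [Finset.sum_const_zero] at h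
  exact le_antisymm (ge_of_tendsto' hlim hbound) zero_le

/-- Decompose by the almost surely finite reachable set `K ⊇ S`. The events that the first or the
second sample matches `f` on `S` are exchanged by swapping the restrictions to `K`, and the
reachable set is symmetric in the two samples. -/
theorem IsQuasiInvariant.ext [Countable Ω] {α : ℝ} (hα : 0 ≤ α) (hΩ : IsSubcritical α Ω)
    {μ μ' : Measure (Equiv.Perm Ω)} [IsProbabilityMeasure μ] [IsProbabilityMeasure μ']
    (hμ : IsQuasiInvariant α μ) (hμ' : IsQuasiInvariant α μ')
    (hfc : ∀ᵐ σ ∂μ, IsFiniteCyclePerm σ) (hfc' : ∀ᵐ σ ∂μ', IsFiniteCyclePerm σ) : μ = μ' := by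
  classical
  refine measure_ext_cylinder fun S f => ?_
  have hae := ae_exists_reachEvent hα hΩ hμ hμ' hfc hfc' S
  let C := cylinder S f
  let T : Finset Ω → Set (Equiv.Perm Ω × Equiv.Perm Ω) := fun K =>
    (C ×ˢ Set.univ) ∩ reachEvent S K
  let T' : Finset Ω → Set (Equiv.Perm Ω × Equiv.Perm Ω) := fun K =>
    (Set.univ ×ˢ C) ∩ reachEvent S K
  have hSK : ∀ K, ∀ q ∈ reachEvent S K, S ⊆ K := fun K q hq => reachEvent_subset hq 0
  have hT1 : ∀ K, ∀ q ∈ T K, ∀ x ∈ K, q.1 x ∈ K ∧ q.2 x ∈ K := fun K q hq =>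
    reachEvent_mapsTo hq.2
  have hT'1 : ∀ K, ∀ q ∈ T' K, ∀ x ∈ K, q.1 x ∈ K ∧ q.2 x ∈ K := fun K q hq =>
    reachEvent_mapsTo hq.2
  have hT2 : ∀ K, ∀ q ∈ T K, ∀ r : Equiv.Perm Ω × Equiv.Perm Ω, (∀ x ∈ K, r.1 x = q.1 x) →
      (∀ x ∈ K, r.2 x = q.2 x) → r ∈ T K := fun K q hq r h h' =>
    ⟨⟨fun x hx => (h x (hSK K q hq.2 hx)).trans (hq.1.1 x hx), trivial⟩,
      reachEvent_congr hq.2 h h'⟩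
  have hT'2 : ∀ K, ∀ q ∈ T' K, ∀ r : Equiv.Perm Ω × Equiv.Perm Ω, (∀ x ∈ K, r.1 x = q.1 x) →
      (∀ x ∈ K, r.2 x = q.2 x) → r ∈ T' K := fun K q hq r h h' =>
    ⟨⟨trivial, fun x hx => (h' x (hSK K q hq.2 hx)).trans (hq.1.2 x hx)⟩,
      reachEvent_congr hq.2 h h'⟩
  have hswap : ∀ K, ∀ q : Equiv.Perm Ω × Equiv.Perm Ω, q.swap ∈ T' K ↔ q ∈ T K := by
    intro K q
    simp only [T, T', Set.mem_inter_iff, reachEvent_swap, Set.mem_prod, Set.mem_univ, true_and,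
      and_true, Prod.snd_swap]
  have hTT' : ∀ K, (μ.prod μ') (T K) = (μ.prod μ') (T' K) := by
    intro K
    rw [hμ.prod_apply_eq_sum hμ' (hT1 K) (hT2 K), hμ.prod_apply_eq_sum hμ' (hT'1 K) (hT'2 K),
      -- Exchange the two permutations of `K`.
      ← Equiv.sum_comp (Equiv.prodComm (Equiv.Perm K) (Equiv.Perm K))]
    refine Finset.sum_congr rfl fun t _ => ?_
    have := hswap K (Equiv.Perm.ofSubtype t.2, Equiv.Perm.ofSubtype t.1)
    by_cases h : (Equiv.Perm.ofSubtype t.2, Equiv.Perm.ofSubtype t.1) ∈ T K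
    · refine (if_pos h).trans (Eq.trans ?_ (if_pos (this.2 h)).symm)
      rw [Equiv.prodComm_apply, Prod.fst_swap, Prod.snd_swap, mul_comm (permWeight α K t.2)]
    · exact (if_neg h).trans (if_neg fun h' => h (this.1 h')).symm
  have htotal : ∀ (A : Set (Equiv.Perm Ω × Equiv.Perm Ω)),
      (∀ K, MeasurableSet (A ∩ reachEvent S K)) →
      (μ.prod μ') A = ∑' K, (μ.prod μ') (A ∩ reachEvent S K) := by
    intro A hA
    rw [← measure_iUnion (fun K K' h => (reachEvent_disjoint h).mono Set.inter_subset_right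
      Set.inter_subset_right) hA, ← Set.inter_iUnion]
    refine measure_congr ?_
    filter_upwards [hae] with q hq
    refine propext ⟨fun h => ⟨h, ?_⟩, fun h => h.1⟩
    simpa using hq
  have h1 : μ C = (μ.prod μ') (C ×ˢ Set.univ) := by simp [Measure.prod_prod]
  have h2 : μ' C = (μ.prod μ') (Set.univ ×ˢ C) := by simp [Measure.prod_prod]
  change μ C = μ' C
  rw [h1, h2, htotal _ fun K => measurableSet_of_locallyDetermined (hT1 K) (hT2 K),
    htotal _ fun K => measurableSet_of_locallyDetermined (hT'1 K) (hT'2 K)]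
  exact tsum_congr hTT'

end Discrete

end SpatialPerm
end

noncomputable section
namespace SpatialPerm
variable {d : ℕ}
variable {Ω : Set (EuclideanSpace ℝ (Fin d))}

/-! ### Finite volume measures -/

open Classical in
/-- The Gibbs measure of the permutations of the finite set `V`. -/
def finiteVolume (α : ℝ) (V : Finset Ω) : Measure (Equiv.Perm Ω) :=
  (∑ τ, permWeight α V τ)⁻¹ •
    ∑ τ : Equiv.Perm V, permWeight α V τ • Measure.dirac (Equiv.Perm.ofSubtype τ)

open Classical in
theorem finiteVolume_apply (α : ℝ) (V : Finset Ω) {A : Set (Equiv.Perm Ω)} (hA : MeasurableSet A) :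
    finiteVolume α V A = (∑ τ, permWeight α V τ)⁻¹ *
      ∑ τ : Equiv.Perm V, permWeight α V τ * A.indicator 1 (Equiv.Perm.ofSubtype τ) := by
  simp only [finiteVolume, Measure.smul_apply, Measure.coe_finsetSum, Finset.sum_apply,
    smul_eq_mul, Measure.dirac_apply' _ hA]

instance (α : ℝ) (V : Finset Ω) : IsProbabilityMeasure (finiteVolume α V) := by
  classical
  constructor
  rw [finiteVolume_apply α V MeasurableSet.univ]
  simp only [Set.indicator_univ, Pi.one_apply, mul_one]
  exact ENNReal.inv_mul_cancel (sum_permWeight_ne_zero α V) (sum_permWeight_ne_top α V)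

theorem exists_path_of_infinite_cycle {σ : Equiv.Perm Ω} {x : Ω}
    (hσ : ¬{y | σ.SameCycle x y}.Finite) (n : ℕ) :
    ∃ p : Fin (n + 1) ↪ Ω, p 0 = x ∧ ∀ i : Fin n, σ (p i.castSucc) = p i.succ := by
  have hper : ∀ k : ℕ, 0 < k → (σ ^ k) x ≠ x := by
    intro k hk h
    refine hσ (((Set.finite_Ico (0 : ℤ) k).image fun m => (σ ^ m) x).subset ?_)
    rintro y ⟨m, rfl⟩
    refine ⟨m % k, ⟨Int.emod_nonneg _ (by omega), Int.emod_lt_of_pos _ (by omega)⟩, ?_⟩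
    have h1 : ((σ ^ k) ^ (m / k)) x = x := Equiv.Perm.zpow_apply_eq_self_of_apply_eq_self h _
    conv_rhs => rw [← Int.emod_add_mul_ediv m k, zpow_add, zpow_mul, zpow_natCast,
      Equiv.Perm.mul_apply, h1]
  have key : ∀ i j : ℕ, i < j → (σ ^ i) x ≠ (σ ^ j) x := by
    intro i j hij h
    refine hper (j - i) (by omega) ((σ ^ i).injective ?_)
    rw [← Equiv.Perm.mul_apply, ← pow_add, Nat.add_sub_cancel' hij.le, h]
  have hinj : Function.Injective fun i : Fin (n + 1) => (σ ^ (i : ℕ)) x := by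
    intro i j h
    rcases lt_trichotomy i j with hij | hij | hij
    · exact absurd h (key i j hij)
    · exact hij
    · exact absurd h.symm (key j i hij)
  refine ⟨⟨_, hinj⟩, rfl, fun i => ?_⟩
  change σ ((σ ^ (i : ℕ)) x) = (σ ^ ((i : ℕ) + 1)) x
  rw [pow_succ', Equiv.Perm.mul_apply]

/-- The indicator of a clopen set is a bounded continuous test function. -/
theorem tendsto_measure_of_isClopen {ι : Type*} {F : Filter ι}
    {μs : ι → ProbabilityMeasure (Equiv.Perm Ω)} {μ : ProbabilityMeasure (Equiv.Perm Ω)}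
    (h : Filter.Tendsto μs F (nhds μ)) {C : Set (Equiv.Perm Ω)} (hC : IsClopen C) :
    Filter.Tendsto (fun i => (μs i : Measure (Equiv.Perm Ω)) C) F
      (nhds ((μ : Measure (Equiv.Perm Ω)) C)) := by
  let f : BoundedContinuousFunction (Equiv.Perm Ω) ℝ≥0 :=
    BoundedContinuousFunction.mkOfBound ⟨C.indicator 1, hC.continuous_indicator continuous_const⟩ 1
      (by
        intro x y
        by_cases hx : x ∈ C <;> by_cases hy : y ∈ C <;> simp [hx, hy, NNReal.dist_eq])
  have hf : ∀ ν : Measure (Equiv.Perm Ω), ∫⁻ σ, f σ ∂ν = ν C := by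
    intro ν
    rw [← lintegral_indicator_one hC.isOpen.measurableSet]
    refine lintegral_congr fun σ => ?_
    change ((C.indicator (1 : Equiv.Perm Ω → ℝ≥0) σ : ℝ≥0) : ℝ≥0∞) = _
    by_cases hσ : σ ∈ C <;> simp [hσ]
  have := ProbabilityMeasure.tendsto_iff_forall_lintegral_tendsto.1 h f
  simpa only [hf] using this

theorem injective_pair {x y : Ω} (h : x ≠ y) : Function.Injective ![x, y] := by
  intro a b hab
  fin_cases a <;> fin_cases b
  · rfl
  · exact absurd hab h
  · exact absurd hab.symm h
  · rfl

theorem tsum_jumpWeight_compl_le_pathSum_one (α : ℝ) (x : Ω) :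
    ∑' y : {y // y ∉ ({x} : Finset Ω)}, jumpWeight α x y ≤ pathSum α x 1 := by
  have hne : ∀ y : {y // y ∉ ({x} : Finset Ω)}, x ≠ y := fun y h =>
    y.2 (Finset.mem_singleton.2 h.symm)
  let j : {y // y ∉ ({x} : Finset Ω)} → {p : Fin (1 + 1) ↪ Ω // p 0 = x} := fun y =>
    ⟨⟨![x, y], injective_pair (hne y)⟩, rfl⟩
  have hj : Function.Injective j := fun y y' h => Subtype.ext (congrArg (fun p => p.1 1) h)
  have hw : ∀ y, pathWeight α (j y).1 = jumpWeight α x y := fun y => Fin.prod_univ_one _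
  calc ∑' y : {y // y ∉ ({x} : Finset Ω)}, jumpWeight α x y
      = ∑' y : {y // y ∉ ({x} : Finset Ω)}, pathWeight α (j y).1 := tsum_congr fun y => (hw y).symm
    _ ≤ pathSum α x 1 := ENNReal.tsum_comp_le_tsum_of_injective hj fun p => pathWeight α p.1

theorem IsSubcritical.pathSum_ne_top {α : ℝ} (hΩ : IsSubcritical α Ω) (x : Ω) (n : ℕ) :
    pathSum α x n ≠ ∞ := by
  have h : 2 ^ n * pathSum α x n ≠ ∞ := ENNReal.ne_top_of_tsum_ne_top (hΩ x) n
  intro h'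
  have h2 : (2 : ℝ≥0∞) ^ n ≠ 0 := pow_ne_zero _ two_ne_zero
  exact h (h' ▸ ENNReal.mul_top h2)

/-- Jumps to other points are one-step self-avoiding paths; staying put contributes `1`. -/
theorem IsSubcritical.tsum_jumpWeight_ne_top {α : ℝ} (hΩ : IsSubcritical α Ω) (x : Ω) :
    ∑' y, jumpWeight α x y ≠ ∞ := by
  have h := ENNReal.tsum_union_le (fun y => jumpWeight α x y) {x} {x}ᶜ
  rw [Set.union_compl_self, tsum_univ (fun y => jumpWeight α x y)] at h
  refine ne_top_of_le_ne_top (ENNReal.add_ne_top.2 ⟨?_, ?_⟩) h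
  · rw [tsum_singleton x (fun y => jumpWeight α x y)]
    exact jumpWeight_ne_top _ _ _
  · refine ne_top_of_le_ne_top (hΩ.pathSum_ne_top x 1)
      (le_trans (le_of_eq ?_) (tsum_jumpWeight_compl_le_pathSum_one α x))
    refine (Equiv.subtypeEquivRight fun y => ?_).tsum_eq
      (fun y : {y // y ∉ ({x} : Finset Ω)} => jumpWeight α x y)
    simp

section Discrete

variable [DiscreteTopology Ω]

theorem measurableSet_jumps {s : Type*} [Finite s] (u v : s → Ω) :
    MeasurableSet {σ : Equiv.Perm Ω | ∀ i, σ (u i) = v i} := by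
  have : {σ : Equiv.Perm Ω | ∀ i, σ (u i) = v i} = ⋂ i, {σ : Equiv.Perm Ω | σ (u i) = v i} := by
    ext; simp
  rw [this]
  exact MeasurableSet.iInter fun i => (isOpen_perm_apply_eq _ _).measurableSet

theorem finiteVolume_jumps_le {α : ℝ} (hα : 0 ≤ α) (V : Finset Ω) {s : Type*} [Fintype s]
    (u v : s → Ω) (hu : Function.Injective u) (hV : ∀ i, u i ∈ V) :
    finiteVolume α V {σ | ∀ i, σ (u i) = v i} ≤ ∏ i, jumpWeight α (u i) (v i) := by
  classical
  rw [finiteVolume_apply α V (measurableSet_jumps u v)]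
  have hap : ∀ (τ : Equiv.Perm V) i, Equiv.Perm.ofSubtype τ (u i) = (τ ⟨u i, hV i⟩ : Ω) :=
    fun τ i => Equiv.Perm.ofSubtype_apply_of_mem _ (hV i)
  by_cases hv : ∀ i, v i ∈ V
  · have h1 : ∀ τ : Equiv.Perm V, permWeight α V τ * Set.indicator
        {σ : Equiv.Perm Ω | ∀ i, σ (u i) = v i} 1 (Equiv.Perm.ofSubtype τ) =
        if ∀ i, τ ⟨u i, hV i⟩ = ⟨v i, hv i⟩ then permWeight α V τ else 0 := by
      intro τ
      have : Equiv.Perm.ofSubtype τ ∈ {σ : Equiv.Perm Ω | ∀ i, σ (u i) = v i} ↔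
          ∀ i, τ ⟨u i, hV i⟩ = ⟨v i, hv i⟩ := by
        refine forall_congr' fun i => ?_
        rw [hap]
        exact ⟨fun h => Subtype.ext h, fun h => congrArg Subtype.val h⟩
      by_cases h : ∀ i, τ ⟨u i, hV i⟩ = ⟨v i, hv i⟩
      · rw [if_pos h, Set.indicator_of_mem (this.2 h), Pi.one_apply, mul_one]
      · rw [if_neg h, Set.indicator_of_notMem (fun h' => h (this.1 h')), mul_zero]
    simp_rw [h1]
    rw [← Finset.sum_filter]
    refine (mul_le_mul_right (sum_permWeight_constrained_le hα V (fun i => ⟨u i, hV i⟩)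
      (fun i => ⟨v i, hv i⟩) fun i j h => hu (Subtype.ext_iff.1 h)) _).trans ?_
    rw [mul_left_comm, ENNReal.inv_mul_cancel (sum_permWeight_ne_zero α V)
      (sum_permWeight_ne_top α V), mul_one]
  · push Not at hv
    obtain ⟨i, hi⟩ := hv
    refine le_of_eq_of_le (mul_eq_zero_of_right _ (Finset.sum_eq_zero ?_)) zero_le
    · intro τ _
      rw [Set.indicator_of_notMem, mul_zero]
      intro h
      apply hi
      rw [← h i, hap]
      exact (τ _).2

/-- Starting points outside `V` are fixed under the finite volume law, so the bound also holds for
them. -/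
theorem finiteVolume_jump_le {α : ℝ} (hα : 0 ≤ α) (V : Finset Ω) (x y : Ω) :
    finiteVolume α V {σ | σ x = y} ≤ jumpWeight α x y := by
  classical
  by_cases hx : x ∈ V
  · have := finiteVolume_jumps_le hα V (fun _ : Unit => x) (fun _ => y)
      (Function.injective_of_subsingleton _) fun _ => hx
    simpa using this
  · by_cases hxy : x = y
    · subst hxy
      rw [jumpWeight_self]
      exact prob_le_one
    · rw [finiteVolume_apply α V (isOpen_perm_apply_eq x y).measurableSet]
      refine le_of_eq_of_le (mul_eq_zero_of_right _ (Finset.sum_eq_zero ?_)) zero_le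
      · intro τ _
        rw [Set.indicator_of_notMem, mul_zero]
        intro h
        apply hxy
        rw [← show _ = y from h, Equiv.Perm.ofSubtype_apply_of_not_mem τ hx]

theorem finiteVolume_quasiInvariant {α : ℝ} {V K : Finset Ω} (hKV : K ⊆ V) {τ : Equiv.Perm Ω}
    (hτ : ∀ x ∉ K, τ x = x) {B : Set (Equiv.Perm Ω)} (hB : MeasurableSet B) (hBK : B ⊆ fixing K) :
    finiteVolume α V ((fun σ => τ⁻¹ * σ) ⁻¹' B) =
      (∏ x ∈ K, jumpWeight α x (τ x)) * finiteVolume α V B := by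
  classical
  have hτV : ∀ x, τ x ∈ V ↔ x ∈ V := by
    intro x
    by_cases hx : x ∈ K
    · refine iff_of_true (hKV ?_) (hKV hx)
      by_contra h
      have := hτ _ h
      rw [τ.injective this] at h
      exact h hx
    · rw [hτ x hx]
  let τV : Equiv.Perm V := τ.subtypePerm hτV
  have hτV' : Equiv.Perm.ofSubtype τV = τ := Equiv.Perm.ofSubtype_subtypePerm hτV fun x hx =>
    hKV (by_contra fun h => hx (hτ x h))
  rw [finiteVolume_apply α V ((continuous_const_mul τ⁻¹).measurable hB), finiteVolume_apply α V hB,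
    mul_left_comm]
  congr 1
  rw [Finset.mul_sum]
  refine (Equiv.sum_comp (Equiv.mulLeft τV) _).symm.trans (Finset.sum_congr rfl fun η _ => ?_)
  have hm : Equiv.Perm.ofSubtype (τV * η) ∈ (fun σ => τ⁻¹ * σ) ⁻¹' B ↔
      Equiv.Perm.ofSubtype η ∈ B := by
    rw [map_mul, hτV', Set.mem_preimage, inv_mul_cancel_left]
  by_cases hη : Equiv.Perm.ofSubtype η ∈ B
  · rw [Equiv.coe_mulLeft, Set.indicator_of_mem (hm.2 hη), Set.indicator_of_mem hη, Pi.one_apply,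
      Pi.one_apply, mul_one, mul_one, ← prod_jumpWeight_ofSubtype, ← prod_jumpWeight_ofSubtype,
      ← Finset.prod_sdiff hKV, ← Finset.prod_sdiff hKV, map_mul, hτV']
    have hfix := mem_fixing.1 (hBK hη)
    rw [mul_comm, ← mul_assoc]
    rw [Finset.prod_eq_one (s := K) (f := fun x => jumpWeight α x (Equiv.Perm.ofSubtype η x)),
      mul_one]
    · congr 1
      · refine Finset.prod_congr rfl fun x hx => ?_
        rw [Equiv.Perm.mul_apply, hfix x hx]
      · refine Finset.prod_congr rfl fun x hx => ?_
        rw [Equiv.Perm.mul_apply, hτ]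
        intro h
        have := hfix _ h
        rw [(Equiv.Perm.ofSubtype η).injective this] at h
        exact (Finset.mem_sdiff.1 hx).2 h
    · intro x hx
      rw [hfix x hx, jumpWeight_self]
  · rw [Equiv.coe_mulLeft, Set.indicator_of_notMem (fun h => hη (hm.1 h)),
      Set.indicator_of_notMem hη, mul_zero, mul_zero, mul_zero]

/-! ### Compactness -/

/-- A pointwise limit of bijections may fail to be surjective, so the inverse is tracked too: the
pairs `(σ, σ⁻¹)` form a closed subset of a product of finite sets. -/
theorem isCompact_boundedJumps (F : Ω → Finset Ω) :
    IsCompact {σ : Equiv.Perm Ω | ∀ x, σ x ∈ F x ∧ σ⁻¹ x ∈ F x} := by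
  have hind : Topology.IsInducing (fun σ : Equiv.Perm Ω => (σ : Ω → Ω)) := ⟨rfl⟩
  rw [hind.isCompact_iff]
  let L : Set ((Ω → Ω) × (Ω → Ω)) :=
    (Set.univ.pi fun x => (F x : Set Ω)) ×ˢ (Set.univ.pi fun x => (F x : Set Ω)) ∩
      {q | ∀ x, q.1 (q.2 x) = x ∧ q.2 (q.1 x) = x}
  have hcomp : ∀ x : Ω, Continuous fun q : (Ω → Ω) × (Ω → Ω) => q.1 (q.2 x) := by
    intro x
    refine continuous_discrete_rng.2 fun z => ?_
    have : (fun q : (Ω → Ω) × (Ω → Ω) => q.1 (q.2 x)) ⁻¹' {z} =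
        ⋃ y : Ω, {q | q.2 x = y} ∩ {q | q.1 y = z} := by
      ext q
      simp only [Set.mem_preimage, Set.mem_singleton_iff, Set.mem_iUnion, Set.mem_inter_iff,
        Set.mem_ofPred_eq]
      exact ⟨fun h => ⟨_, rfl, h⟩, fun ⟨y, h1, h2⟩ => by rw [h1, h2]⟩
    rw [this]
    refine isOpen_iUnion fun y => IsOpen.inter ?_ ?_
    · exact (isOpen_discrete ({y} : Set Ω)).preimage
        (f := fun q : (Ω → Ω) × (Ω → Ω) => q.2 x) (by fun_prop)
    · exact (isOpen_discrete ({z} : Set Ω)).preimage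
        (f := fun q : (Ω → Ω) × (Ω → Ω) => q.1 y) (by fun_prop)
  have hL : IsCompact L := by
    have hF : IsCompact (Set.univ.pi fun x => (F x : Set Ω)) :=
      isCompact_univ_pi fun x => (F x).finite_toSet.isCompact
    refine (hF.prod hF).inter_right ?_
    simp only [Set.ofPred_forall]
    refine isClosed_iInter fun x => IsClosed.inter ?_ ?_
    · exact isClosed_eq (hcomp x) continuous_const
    · exact isClosed_eq ((hcomp x).comp continuous_swap) continuous_const
  convert hL.image continuous_fst using 1
  ext f
  constructor
  · rintro ⟨σ, hσ, rfl⟩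
    refine ⟨(σ, (σ⁻¹ : Equiv.Perm Ω)), ⟨⟨fun x _ => (hσ x).1, fun x _ => (hσ x).2⟩, fun x => ?_⟩,
      rfl⟩
    simp
  · rintro ⟨⟨f, g⟩, ⟨⟨hf, hg⟩, h⟩, rfl⟩
    refine ⟨⟨f, g, fun x => (h x).2, fun x => (h x).1⟩, fun x => ⟨hf x trivial, hg x trivial⟩, rfl⟩

/-- Jumps out of and into `x` have the same weight bounds, with summable tails. The factor `2` in
the choice of `F x` pays for `σ` and `σ⁻¹`. -/
theorem isTightMeasureSet_finiteVolume [Countable Ω] {α : ℝ} (hα : 0 ≤ α)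
    (hΩ : IsSubcritical α Ω) : IsTightMeasureSet (Set.range (finiteVolume (Ω := Ω) α)) := by
  classical
  rw [isTightMeasureSet_iff_exists_isCompact_measure_compl_le]
  intro ε hε
  obtain ⟨δ, hδ, hδε⟩ := ENNReal.exists_pos_sum_of_countable' hε.ne' Ω
  have hF : ∀ x : Ω, ∃ F : Finset Ω,
      2 * ∑' y : {y // y ∉ F}, jumpWeight α x y ≤ δ x := by
    intro x
    have h := ENNReal.tendsto_tsum_compl_atTop_zero (hΩ.tsum_jumpWeight_ne_top x)
    have h' := ENNReal.Tendsto.const_mul h (Or.inr (ENNReal.ofNat_ne_top (n := 2)))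
    rw [mul_zero] at h'
    obtain ⟨F, hF⟩ := (h'.eventually (ge_mem_nhds (hδ x))).exists
    exact ⟨F, hF⟩
  choose F hF using hF
  refine ⟨_, isCompact_boundedJumps F, ?_⟩
  rintro _ ⟨V, rfl⟩
  have hsub : {σ : Equiv.Perm Ω | ∀ x, σ x ∈ F x ∧ σ⁻¹ x ∈ F x}ᶜ ⊆
      ⋃ x, ⋃ y : {y // y ∉ F x}, {σ : Equiv.Perm Ω | σ x = y} ∪ {σ | σ y = x} := by
    intro σ hσ
    simp only [Set.mem_compl_iff, Set.mem_ofPred_eq, not_forall] at hσ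
    obtain ⟨x, hx⟩ := hσ
    simp only [Set.mem_iUnion]
    by_cases h : σ x ∈ F x
    · have h' : σ⁻¹ x ∉ F x := fun h' => hx ⟨h, h'⟩
      exact ⟨x, ⟨σ⁻¹ x, h'⟩, Or.inr (by simp)⟩
    · exact ⟨x, ⟨σ x, h⟩, Or.inl rfl⟩
  calc finiteVolume α V _ ≤ _ := measure_mono hsub
    _ ≤ ∑' x, finiteVolume α V (⋃ y : {y // y ∉ F x}, {σ : Equiv.Perm Ω | σ x = y} ∪
          {σ | σ y = x}) := measure_iUnion_le _
    _ ≤ ∑' x, δ x := by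
        refine ENNReal.tsum_le_tsum fun x => (measure_iUnion_le _).trans ((hF x).trans' ?_)
        rw [← ENNReal.tsum_mul_left]
        refine ENNReal.tsum_le_tsum fun y => (measure_union_le _ _).trans ?_
        rw [two_mul]
        refine add_le_add (finiteVolume_jump_le hα V x y) ?_
        rw [jumpWeight_comm]
        exact finiteVolume_jump_le hα V y x
    _ ≤ ε := hδε.le

theorem exists_isQuasiInvariant [Countable Ω] {α : ℝ} (hα : 0 ≤ α) (hΩ : IsSubcritical α Ω) :
    ∃ μ : Measure (Equiv.Perm Ω), IsProbabilityMeasure μ ∧ IsQuasiInvariant α μ ∧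
      ∀ᵐ σ ∂μ, IsFiniteCyclePerm σ := by
  classical
  let ν : Finset Ω → ProbabilityMeasure (Equiv.Perm Ω) := fun V => ⟨finiteVolume α V, inferInstance⟩
  have hcomp : IsCompact (closure (Set.range ν)) := by
    refine isCompact_closure_of_isTightMeasureSet
      ((isTightMeasureSet_finiteVolume hα hΩ).subset ?_)
    rintro _ ⟨_, ⟨V, rfl⟩, rfl⟩
    exact ⟨V, rfl⟩
  -- An ultrafilter finer than `atTop` converges in the compact closure and eventually contains
  -- every finite set.
  let 𝒰 : Ultrafilter (Finset Ω) := Ultrafilter.of Filter.atTop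
  obtain ⟨μ, -, hμ⟩ := hcomp.ultrafilter_le_nhds (𝒰.map ν) (by
    refine Filter.le_principal_iff.2 ?_
    exact Filter.mem_map.2 (Filter.univ_mem' fun V => subset_closure ⟨V, rfl⟩))
  have hlim : Filter.Tendsto ν 𝒰 (nhds μ) := hμ
  have hcl : ∀ C : Set (Equiv.Perm Ω), IsClopen C → Filter.Tendsto (fun V => finiteVolume α V C) 𝒰
      (nhds ((μ : Measure (Equiv.Perm Ω)) C)) := fun C hC => tendsto_measure_of_isClopen hlim hC
  have hev : ∀ K : Finset Ω, ∀ᶠ V in (𝒰 : Filter (Finset Ω)), K ⊆ V := fun K =>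
    Ultrafilter.of_le _ (Filter.eventually_ge_atTop K)
  refine ⟨μ, inferInstance, ?_, ?_⟩
  · intro K τ hτ B hB hBK
    have hmeas : Measurable fun σ => τ⁻¹ * σ := (continuous_const_mul τ⁻¹).measurable
    have hW : (∏ x ∈ K, jumpWeight α x (τ x)) ≠ ∞ :=
      ENNReal.prod_ne_top fun _ _ => jumpWeight_ne_top _ _ _
    -- Weak limits control only clopen sets, so the identity is proved as an equality of measures,
    -- tested on cylinders, and then evaluated at `B`.
    have key : ((μ : Measure (Equiv.Perm Ω)).map (fun σ => τ⁻¹ * σ)).restrict (fixing K) =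
        (∏ x ∈ K, jumpWeight α x (τ x)) • (μ : Measure (Equiv.Perm Ω)).restrict (fixing K) := by
      have : IsFiniteMeasure ((μ : Measure (Equiv.Perm Ω)).map (fun σ => τ⁻¹ * σ)) :=
        Measure.isFiniteMeasure_map _ _
      refine measure_ext_cylinder fun S f => ?_
      have hC : IsClopen (cylinder S f ∩ fixing K) :=
        (isClopen_cylinder S f).inter (isClopen_cylinder K id)
      rw [Measure.restrict_apply (measurableSet_cylinder S f), Measure.smul_apply,
        Measure.restrict_apply (measurableSet_cylinder S f), Measure.map_apply hmeas
          hC.isOpen.measurableSet, smul_eq_mul]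
      refine tendsto_nhds_unique (hcl _ (hC.preimage (continuous_const_mul τ⁻¹))) ?_
      refine (ENNReal.Tendsto.const_mul (hcl _ hC) (Or.inr hW)).congr' ?_
      filter_upwards [hev K] with V hV
      exact (finiteVolume_quasiInvariant hV hτ hC.isOpen.measurableSet
        Set.inter_subset_right).symm
    have h := congrArg (fun m : Measure (Equiv.Perm Ω) => m B) key
    simp only [Measure.smul_apply, Measure.restrict_apply hB, smul_eq_mul,
      Set.inter_eq_left.2 hBK, Measure.map_apply hmeas hB] at h
    exact h
  · have hpath : ∀ {n : ℕ} (p : Fin (n + 1) ↪ Ω), (μ : Measure (Equiv.Perm Ω))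
        {σ | ∀ i : Fin n, σ (p i.castSucc) = p i.succ} ≤ pathWeight α p := by
      intro n p
      have hC : IsClopen {σ : Equiv.Perm Ω | ∀ i : Fin n, σ (p i.castSucc) = p i.succ} := by
        have : {σ : Equiv.Perm Ω | ∀ i : Fin n, σ (p i.castSucc) = p i.succ} =
            ⋂ i : Fin n, (fun σ : Equiv.Perm Ω => σ (p i.castSucc)) ⁻¹' {p i.succ} := by
          ext σ; simp
        rw [this]
        exact isClopen_iInter_of_finite fun i =>
          (isClopen_discrete _).preimage (continuous_perm_apply _)
      refine le_of_tendsto (hcl _ hC) ?_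
      filter_upwards [hev (Finset.univ.map p)] with V hV
      exact finiteVolume_jumps_le hα V (fun i : Fin n => p i.castSucc) (fun i => p i.succ)
        (fun i j h => Fin.castSucc_injective n (p.injective h))
        fun i => hV (Finset.mem_map_of_mem p (Finset.mem_univ _))
    unfold IsFiniteCyclePerm
    rw [ae_all_iff]
    intro x
    -- An infinite cycle contains a self-avoiding path of every length from `x`; the extra `2 ^ n`
    -- only matches the available limit.
    have hbound : ∀ n, (μ : Measure (Equiv.Perm Ω)) {σ | ¬{y | σ.SameCycle x y}.Finite} ≤
        2 ^ n * pathSum α x n := by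
      intro n
      have hsub : {σ : Equiv.Perm Ω | ¬{y | σ.SameCycle x y}.Finite} ⊆
          ⋃ p : {p : Fin (n + 1) ↪ Ω // p 0 = x},
            {σ | ∀ i : Fin n, σ (p.1 i.castSucc) = p.1 i.succ} := by
        intro σ hσ
        obtain ⟨p, hp0, hp⟩ := exists_path_of_infinite_cycle hσ n
        exact Set.mem_iUnion.2 ⟨⟨p, hp0⟩, hp⟩
      have h2 : (1 : ℝ≥0∞) ≤ 2 ^ n := one_le_pow₀ one_le_two
      calc _ ≤ _ := measure_mono hsub
        _ ≤ ∑' p : {p : Fin (n + 1) ↪ Ω // p 0 = x}, (μ : Measure (Equiv.Perm Ω))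
            {σ | ∀ i : Fin n, σ (p.1 i.castSucc) = p.1 i.succ} := measure_iUnion_le _
        _ ≤ ∑' p : {p : Fin (n + 1) ↪ Ω // p 0 = x}, pathWeight α p.1 :=
          ENNReal.tsum_le_tsum fun p => hpath p.1
        _ = 1 * pathSum α x n := (one_mul _).symm
        _ ≤ 2 ^ n * pathSum α x n := by gcongr
    exact le_antisymm (ge_of_tendsto' (hΩ.tendsto x) hbound) zero_le

/-- On a subcritical locally finite set there is exactly one Gibbs measure supported on finite
cycle permutations. -/
theorem existsUnique_isGibbs
    (hfin : ∀ K : Set (EuclideanSpace ℝ (Fin d)), IsCompact K → (Ω ∩ K).Finite) [Countable Ω]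
    {α : ℝ} (hα : 0 ≤ α) (hΩ : IsSubcritical α Ω) :
    ∃! μ : Measure (Equiv.Perm Ω), IsGibbs Ω α μ ∧ ∀ᵐ σ ∂μ, IsFiniteCyclePerm σ := by
  obtain ⟨μ, hp, hq, hfc⟩ := exists_isQuasiInvariant hα hΩ
  refine ⟨μ, ⟨hq.isGibbs hfin, hfc⟩, ?_⟩
  rintro μ' ⟨hg', hfc'⟩
  have := hg'.isProbability
  exact hg'.isQuasiInvariant.ext hα hΩ hq hfc' hfc

end Discrete

end SpatialPerm
end

noncomputable section
namespace SpatialPerm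
variable {d : ℕ}

/-! ### Unit cells -/

/-- The lattice point of the unit cell that contains `z`. -/
def site (z : EuclideanSpace ℝ (Fin d)) : Fin d → ℤ := fun i => ⌊z i⌋

/-- The unit cell with lower corner `c`. -/
def cell (c : Fin d → ℤ) : Set (EuclideanSpace ℝ (Fin d)) := {z | site z = c}

theorem cell_eq_preimage (c : Fin d → ℤ) :
    cell c = (WithLp.ofLp : EuclideanSpace ℝ (Fin d) → Fin d → ℝ) ⁻¹'
      Set.univ.pi fun i => Set.Ico (c i : ℝ) (c i + 1) := by
  ext z
  simp only [cell, site, Set.mem_preimage, Set.mem_pi, Set.mem_univ, true_imp_iff,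
    funext_iff, Int.floor_eq_iff, Set.mem_Ico, Set.mem_ofPred_eq]

theorem measurableSet_cell (c : Fin d → ℤ) : MeasurableSet (cell c) := by
  rw [cell_eq_preimage]
  exact (PiLp.volume_preserving_ofLp (Fin d)).measurable
    (MeasurableSet.univ_pi fun i => measurableSet_Ico)

theorem volume_cell (c : Fin d → ℤ) : volume (cell c) = 1 := by
  rw [cell_eq_preimage, (PiLp.volume_preserving_ofLp (Fin d)).measure_preimage
    (MeasurableSet.univ_pi fun i => measurableSet_Ico).nullMeasurableSet, Real.volume_pi_Ico]
  simp

theorem disjoint_cell {c c' : Fin d → ℤ} (h : c ≠ c') : Disjoint (cell c) (cell c') :=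
  Set.disjoint_left.2 fun _ hz hz' => h (hz.symm.trans hz')

/-- Rounding moves each coordinate of `y - x` by a difference of two fractional parts, hence by less
than `1`. -/
theorem norm_sub_latticePoint_le (x y : EuclideanSpace ℝ (Fin d)) :
    ‖latticePoint (site y - site x)‖ - √(d : ℝ) ≤ ‖y - x‖ := by
  have h : ‖latticePoint (site y - site x) - (y - x)‖ ≤ √(d : ℝ) := by
    rw [EuclideanSpace.norm_eq]
    refine Real.sqrt_le_sqrt ?_
    have : ∀ i : Fin d, ‖(latticePoint (site y - site x) - (y - x)) i‖ ^ 2 ≤ 1 := by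
      intro i
      have h1 : (latticePoint (site y - site x) - (y - x)) i = Int.fract (x i) - Int.fract (y i) := by
        simp only [latticePoint, site, PiLp.sub_apply, Pi.sub_apply, Int.cast_sub, Int.fract]
        ring
      rw [h1, Real.norm_eq_abs, sq_abs]
      have := Int.fract_nonneg (x i)
      have := Int.fract_nonneg (y i)
      have := Int.fract_lt_one (x i)
      have := Int.fract_lt_one (y i)
      nlinarith
    calc _ ≤ ∑ _i : Fin d, (1 : ℝ) := Finset.sum_le_sum fun i _ => this i
      _ = d := by simp
  have h2 := norm_le_norm_add_norm_sub (y - x) (latticePoint (site y - site x))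
  rw [norm_sub_rev (y - x)] at h2
  linarith

theorem isBounded_cell (c : Fin d → ℤ) : Bornology.IsBounded (cell c) := by
  rw [Metric.isBounded_iff]
  refine ⟨√(d : ℝ), fun x hx y hy => ?_⟩
  have hx' : site x = c := hx
  have hy' : site y = c := hy
  rw [dist_eq_norm, EuclideanSpace.norm_eq]
  refine Real.sqrt_le_sqrt ?_
  have : ∀ i : Fin d, ‖(x - y) i‖ ^ 2 ≤ 1 := by
    intro i
    have h1 := Int.floor_eq_iff.1 (congrFun hx' i)
    have h2 := Int.floor_eq_iff.1 (congrFun hy' i)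
    rw [PiLp.sub_apply, Real.norm_eq_abs, sq_abs]
    nlinarith
  calc _ ≤ ∑ _i : Fin d, (1 : ℝ) := Finset.sum_le_sum fun i _ => this i
    _ = d := by simp

/-- The lattice weight that dominates the jump weights between two cells. -/
def latticeWeight (d : ℕ) (α : ℝ) (c : Fin d → ℤ) : ℝ≥0∞ :=
  ENNReal.ofReal (Real.exp (-α * truncatedPotential d (latticePoint c)))

/-- With `n` the distance between cell corners, `‖y - x‖ ≥ n - √d`. Squaring gives at least `n² -
2√d n` when `n > 2√d`; otherwise the potential vanishes. -/
theorem jumpWeight_le_latticeWeight {Ω : Set (EuclideanSpace ℝ (Fin d))} {α : ℝ} (hα : 0 ≤ α)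
    (x y : Ω) : jumpWeight α x y ≤
      latticeWeight d α (site (y : EuclideanSpace ℝ (Fin d)) - site (x : EuclideanSpace ℝ (Fin d))) := by
  refine ENNReal.ofReal_le_ofReal (Real.exp_le_exp.2 ?_)
  have h := norm_sub_latticePoint_le (x : EuclideanSpace ℝ (Fin d)) y
  set n := ‖latticePoint (site (y : EuclideanSpace ℝ (Fin d)) -
    site (x : EuclideanSpace ℝ (Fin d)))‖ with hn
  have hs : 0 ≤ √(d : ℝ) := Real.sqrt_nonneg _
  have hV : truncatedPotential d (latticePoint (site (y : EuclideanSpace ℝ (Fin d)) -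
      site (x : EuclideanSpace ℝ (Fin d)))) ≤ ‖(y : EuclideanSpace ℝ (Fin d)) - x‖ ^ 2 := by
    refine max_le ?_ (by positivity)
    rw [← hn]
    by_cases h2 : n ≤ 2 * √(d : ℝ)
    · have : 0 ≤ n := norm_nonneg _
      nlinarith [sq_nonneg ‖(y : EuclideanSpace ℝ (Fin d)) - x‖]
    · push Not at h2
      nlinarith [norm_nonneg ((y : EuclideanSpace ℝ (Fin d)) - x)]
  nlinarith

/-- By translation invariance, summing over the last site contributes one factor `φ_V(α)`. -/
theorem tsum_latticePath (α : ℝ) (c₀ : Fin d → ℤ) (n : ℕ) :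
    ∑' c : Fin (n + 1) → Fin d → ℤ, (if c 0 = c₀ then
      ∏ i : Fin n, latticeWeight d α (c i.succ - c i.castSucc) else 0) =
      phi (truncatedPotential d) α ^ n := by
  induction n with
  | zero =>
    rw [← (Equiv.funUnique (Fin 1) (Fin d → ℤ)).symm.tsum_eq]
    simp
  | succ n ih =>
    rw [← (Fin.snocEquiv fun _ : Fin (n + 2) => Fin d → ℤ).tsum_eq,
      ENNReal.tsum_prod', ENNReal.tsum_comm, pow_succ, ← ih, ← ENNReal.tsum_mul_right]
    refine tsum_congr fun c => ?_
    have h0 : ∀ z : Fin d → ℤ, (Fin.snoc c z : Fin (n + 2) → Fin d → ℤ) 0 = c 0 := fun z =>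
      Fin.snoc_castSucc (α := fun _ => Fin d → ℤ) z c 0
    have hp : ∀ z : Fin d → ℤ, ∏ i : Fin (n + 1), latticeWeight d α
        ((Fin.snoc c z : Fin (n + 2) → Fin d → ℤ) i.succ -
          (Fin.snoc c z : Fin (n + 2) → Fin d → ℤ) i.castSucc) =
        (∏ i : Fin n, latticeWeight d α (c i.succ - c i.castSucc)) *
          latticeWeight d α (z - c (Fin.last n)) := by
      intro z
      rw [Fin.prod_univ_castSucc]
      congr 1
      · refine Finset.prod_congr rfl fun i _ => ?_
        rw [Fin.succ_castSucc, Fin.snoc_castSucc, Fin.snoc_castSucc]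
      · rw [Fin.succ_last, Fin.snoc_last, Fin.snoc_castSucc]
    change ∑' z : Fin d → ℤ, (if (Fin.snoc c z : Fin (n + 2) → Fin d → ℤ) 0 = c₀ then
      ∏ i : Fin (n + 1), latticeWeight d α ((Fin.snoc c z : Fin (n + 2) → Fin d → ℤ) i.succ -
          (Fin.snoc c z : Fin (n + 2) → Fin d → ℤ) i.castSucc) else 0) = _
    simp_rw [h0, hp]
    by_cases hc : c 0 = c₀
    · simp only [if_pos hc]
      rw [ENNReal.tsum_mul_left]
      congr 1
      exact (Equiv.subRight (c (Fin.last n))).tsum_eq (fun z => latticeWeight d α z)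
    · simp only [if_neg hc, tsum_zero, zero_mul]

/-! ### Factorial moments -/

/-- Terms with `k < m` vanish; after the shift `k ↦ k + m` the falling factorial cancels the excess
in the factorial and `r ^ m` factors out. -/
theorem lintegral_descFactorial_poisson (r : ℝ≥0) (m : ℕ) :
    ∫⁻ k, (k.descFactorial m : ℝ≥0∞) ∂(poissonMeasure r) = (r : ℝ≥0∞) ^ m := by
  rw [lintegral_countable', ← (add_left_injective m).tsum_eq]
  · have h : ∀ k : ℕ, ((k + m).descFactorial m : ℝ≥0∞) * poissonMeasure r {k + m} =
        (r : ℝ≥0∞) ^ m * poissonMeasure r {k} := by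
      intro k
      rw [poissonMeasure_singleton, poissonMeasure_singleton, ← ENNReal.ofReal_natCast,
        ← ENNReal.ofReal_mul (by positivity), ← ENNReal.ofReal_coe_nnreal,
        ← ENNReal.ofReal_pow (by positivity), ← ENNReal.ofReal_mul (by positivity)]
      congr 1
      have h1 : ((k + m).factorial : ℝ) = k.factorial * (k + m).descFactorial m := by
        have := Nat.factorial_mul_descFactorial (Nat.le_add_left m k)
        rw [Nat.add_sub_cancel] at this
        exact_mod_cast this.symm
      have h2 : ((k + m).descFactorial m : ℝ) ≠ 0 := by
        intro h
        rw [h, mul_zero] at h1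
        exact (Nat.factorial_ne_zero (k + m)) (by exact_mod_cast h1)
      rw [h1, pow_add]
      field_simp
    simp_rw [h]
    rw [ENNReal.tsum_mul_left]
    have h1 := lintegral_countable' (μ := poissonMeasure r) (fun _ => 1)
    simp only [lintegral_const, one_mul, measure_univ] at h1
    rw [← h1, mul_one]
  · intro k hk
    rw [Function.mem_support] at hk
    refine ⟨k - m, Nat.sub_add_cancel ?_⟩
    by_contra h
    exact hk (by rw [Nat.descFactorial_of_lt (by omega)]; simp)

/-- A bound for the number of injective maps into a point configuration with prescribed cells. -/
def cellCount {κ : Type*} [Fintype κ] [DecidableEq κ] (Ω : Set (EuclideanSpace ℝ (Fin d)))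
    (c : κ → Fin d → ℤ) : ℕ :=
  ∏ b ∈ Finset.univ.image c, (Ω ∩ cell b).ncard.descFactorial (Fintype.card {i // c i = b})

/-- Counts in distinct unit cells are independent Poisson(`ρ`), and the fibres of `c` have total
size `|κ|`. Falling factorials make the mean the same even when `c` revisits cells. -/
theorem IsPoissonProcess.lintegral_cellCount {E : Type*} [MeasurableSpace E] {P : Measure E}
    [IsProbabilityMeasure P] {ρ : ℝ≥0} {Ω : E → Set (EuclideanSpace ℝ (Fin d))}
    (hΩ : IsPoissonProcess P ρ Ω) {κ : Type*} [Fintype κ] [DecidableEq κ] (c : κ → Fin d → ℤ) :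
    Measurable (fun ω => (cellCount (Ω ω) c : ℝ≥0∞)) ∧
      ∫⁻ ω, (cellCount (Ω ω) c : ℝ≥0∞) ∂P = (ρ : ℝ≥0∞) ^ Fintype.card κ := by
  classical
  let I : Finset (Fin d → ℤ) := Finset.univ.image c
  let e := I.equivFin
  let b : Fin I.card → Fin d → ℤ := fun j => e.symm j
  have hb : Function.Injective b := fun i j h => e.symm.injective (Subtype.ext h)
  have hind := hΩ.indep_count I.card (fun j => cell (b j)) (fun j => measurableSet_cell _)
    (fun j => isBounded_cell _) (fun i j hij => disjoint_cell fun h => hij (hb h))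
  let m : (Fin d → ℤ) → ℕ := fun z => Fintype.card {i // c i = z}
  have hmeasN : ∀ z, Measurable fun ω => (Ω ω ∩ cell z).ncard := fun z =>
    hΩ.measurable_count _ (measurableSet_cell z) (isBounded_cell z)
  have hf : ∀ k : ℕ, Measurable fun n : ℕ => (n.descFactorial k : ℝ≥0∞) := fun k =>
    measurable_from_top
  have hprod : ∀ ω, (cellCount (Ω ω) c : ℝ≥0∞) =
      ∏ j, (((Ω ω ∩ cell (b j)).ncard.descFactorial (m (b j)) : ℕ) : ℝ≥0∞) := by
    intro ω
    rw [cellCount, Nat.cast_prod]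
    change ∏ z ∈ I, (((Ω ω ∩ cell z).ncard.descFactorial (m z) : ℕ) : ℝ≥0∞) = _
    rw [← Finset.prod_coe_sort, ← Equiv.prod_comp e.symm]
  simp_rw [hprod]
  have hind' := hind.comp (fun j n => (n.descFactorial (m (b j)) : ℝ≥0∞)) fun j => hf _
  refine ⟨Finset.measurable_fun_prod _ fun j _ => (hf _).comp (hmeasN _), ?_⟩
  have h := lintegral_prod_eq_prod_lintegral_of_indepFun Finset.univ
    (fun j ω => (((Ω ω ∩ cell (b j)).ncard.descFactorial (m (b j)) : ℕ) : ℝ≥0∞)) hind'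
    fun j => (hf _).comp (hmeasN _)
  rw [h]
  have h1 : ∀ z, ∫⁻ ω, (((Ω ω ∩ cell z).ncard.descFactorial (m z) : ℕ) : ℝ≥0∞) ∂P =
      (ρ : ℝ≥0∞) ^ m z := by
    intro z
    rw [← lintegral_descFactorial_poisson, ← lintegral_map (hf (m z)) (hmeasN z),
      hΩ.law_count _ (measurableSet_cell z) (isBounded_cell z), volume_cell]
    simp
  simp_rw [h1]
  rw [Finset.prod_pow_eq_pow_sum]
  congr 1
  have h2 : ∑ j, m (b j) = ∑ z ∈ I, m z := by
    rw [← Finset.sum_coe_sort I]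
    exact Equiv.sum_comp e.symm fun z : I => m z
  rw [h2]
  have h3 := Finset.card_eq_sum_card_image c (Finset.univ : Finset κ)
  rw [← Finset.card_univ, h3]
  exact Finset.sum_congr rfl fun z _ => Fintype.card_subtype _

/-- An injective map splits into injections of each fibre of `c` into the points of its cell. -/
theorem card_embedding_cell_le {Ω : Set (EuclideanSpace ℝ (Fin d))}
    (hfin : ∀ K : Set (EuclideanSpace ℝ (Fin d)), IsCompact K → (Ω ∩ K).Finite)
    {κ : Type*} [Fintype κ] [DecidableEq κ] (c : κ → Fin d → ℤ) :
    ENat.card {p : κ ↪ Ω // (fun i => site (p i : EuclideanSpace ℝ (Fin d))) = c} ≤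
      cellCount Ω c := by
  classical
  have hcell : ∀ b, (Ω ∩ cell b).Finite := fun b =>
    (hfin _ (isBounded_cell b).isCompact_closure).subset
      (Set.inter_subset_inter_right _ subset_closure)
  have : ∀ b, Fintype (Ω ∩ cell b : Set _) := fun b => (hcell b).fintype
  let T := ∀ b : Finset.univ.image c, {i // c i = b} ↪ (Ω ∩ cell b.1 : Set _)
  let J : {p : κ ↪ Ω // (fun i => site (p i : EuclideanSpace ℝ (Fin d))) = c} → T := fun p b =>
    ⟨fun i => ⟨p.1 i.1, (p.1 i.1).2, (congrFun p.2 i.1).trans i.2⟩, fun i j h => by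
      have h' := congrArg Subtype.val h
      exact Subtype.ext (p.1.injective (Subtype.ext h'))⟩
  have hJ : Function.Injective J := by
    intro p p' h
    refine Subtype.ext (DFunLike.ext _ _ fun i => Subtype.ext ?_)
    have h1 := congrFun h ⟨c i, Finset.mem_image_of_mem c (Finset.mem_univ i)⟩
    have h2 := DFunLike.congr_fun h1 ⟨i, rfl⟩
    have h3 := congrArg Subtype.val h2
    exact h3
  refine (ENat.card_le_card_of_injective hJ).trans (le_of_eq ?_)
  rw [ENat.card_eq_coe_fintype_card, Fintype.card_pi, cellCount, ← Finset.prod_coe_sort (Finset.univ.image c)]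
  congr 1
  refine Finset.prod_congr rfl fun b _ => ?_
  rw [Fintype.card_embedding_eq, ← Nat.card_coe_set_eq, Nat.card_eq_fintype_card]

/-- Group paths by their cells, relaxing the starting point `x` to its cell; the bound then depends
on `x` only through a lattice site. -/
theorem pathSum_le_tsum_cellCount {Ω : Set (EuclideanSpace ℝ (Fin d))}
    (hfin : ∀ K : Set (EuclideanSpace ℝ (Fin d)), IsCompact K → (Ω ∩ K).Finite)
    {α : ℝ} (hα : 0 ≤ α) (x : Ω) (n : ℕ) :
    pathSum α x n ≤ ∑' c : Fin (n + 1) → Fin d → ℤ,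
      (if c 0 = site (x : EuclideanSpace ℝ (Fin d)) then
        ∏ i : Fin n, latticeWeight d α (c i.succ - c i.castSucc) else 0) * cellCount Ω c := by
  let S : (Fin (n + 1) ↪ Ω) → Fin (n + 1) → Fin d → ℤ := fun p i =>
    site (p i : EuclideanSpace ℝ (Fin d))
  let w : (Fin (n + 1) → Fin d → ℤ) → ℝ≥0∞ := fun c =>
    if c 0 = site (x : EuclideanSpace ℝ (Fin d)) then
        ∏ i : Fin n, latticeWeight d α (c i.succ - c i.castSucc) else 0
  calc pathSum α x n ≤ ∑' p : {p : Fin (n + 1) ↪ Ω // p 0 = x}, w (S p.1) := by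
        refine ENNReal.tsum_le_tsum fun p => ?_
        have h0 : S p.1 0 = site (x : EuclideanSpace ℝ (Fin d)) := by
          simp only [S, p.2]
        simp only [w, if_pos h0]
        exact Finset.prod_le_prod' fun i _ => jumpWeight_le_latticeWeight hα _ _
    _ ≤ ∑' p : Fin (n + 1) ↪ Ω, w (S p) :=
        ENNReal.tsum_comp_le_tsum_of_injective Subtype.val_injective fun p => w (S p)
    _ = ∑' c, ∑' p : S ⁻¹' {c}, w (S p) := (ENNReal.tsum_fiberwise _ S).symm
    _ = ∑' c, ∑' _ : S ⁻¹' {c}, w c :=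
        tsum_congr fun c => tsum_congr fun p => congrArg w p.2
    _ ≤ ∑' c, w c * cellCount Ω c := by
        refine ENNReal.tsum_le_tsum fun c => ?_
        rw [ENNReal.tsum_const, mul_comm]
        gcongr
        have h := card_embedding_cell_le hfin c
        exact_mod_cast (ENat.toENNReal_le.2 h)

/-- Almost every realization of a sparse Poisson process is subcritical. -/
theorem IsPoissonProcess.ae_isSubcritical {E : Type*} [MeasurableSpace E] {P : Measure E}
    [IsProbabilityMeasure P] {ρ : ℝ≥0} {Ω : E → Set (EuclideanSpace ℝ (Fin d))}
    (hΩ : IsPoissonProcess P ρ Ω) {α : ℝ} (hα : 0 ≤ α)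
    (h : 2 * (ρ * phi (truncatedPotential d) α) < 1) : ∀ᵐ ω ∂P, IsSubcritical α (Ω ω) := by
  let w : (Fin d → ℤ) → (n : ℕ) → (Fin (n + 1) → Fin d → ℤ) → ℝ≥0∞ := fun c₀ n c =>
    if c 0 = c₀ then ∏ i : Fin n, latticeWeight d α (c i.succ - c i.castSucc) else 0
  -- Starting cells are deterministic and countable, unlike the random points, so one null set
  -- serves all of them.
  have key : ∀ c₀ : Fin d → ℤ, ∀ᵐ ω ∂P, ∑' n, 2 ^ n * ∑' c, w c₀ n c * cellCount (Ω ω) c < ∞ := by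
    intro c₀
    have hm : ∀ (n : ℕ) (c : Fin (n + 1) → Fin d → ℤ),
        Measurable fun ω => w c₀ n c * (cellCount (Ω ω) c : ℝ≥0∞) := fun n c =>
      (hΩ.lintegral_cellCount c).1.const_mul _
    have hm' : ∀ n : ℕ, Measurable fun ω => ∑' c, w c₀ n c * (cellCount (Ω ω) c : ℝ≥0∞) :=
      fun n => Measurable.tsum fun c => hm n c
    refine ae_lt_top (Measurable.tsum fun n => (hm' n).const_mul _) ?_
    rw [lintegral_tsum fun n => ((hm' n).const_mul _).aemeasurable]
    have hn : ∀ n : ℕ, ∫⁻ ω, 2 ^ n * ∑' c, w c₀ n c * (cellCount (Ω ω) c : ℝ≥0∞) ∂P =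
        ρ * (2 * (ρ * phi (truncatedPotential d) α)) ^ n := by
      intro n
      rw [lintegral_const_mul _ (hm' n), lintegral_tsum fun c => (hm n c).aemeasurable]
      have hc : ∀ c, ∫⁻ ω, w c₀ n c * (cellCount (Ω ω) c : ℝ≥0∞) ∂P =
          w c₀ n c * (ρ : ℝ≥0∞) ^ (n + 1) := by
        intro c
        rw [lintegral_const_mul _ (hΩ.lintegral_cellCount c).1, (hΩ.lintegral_cellCount c).2,
          Fintype.card_fin]
      simp_rw [hc]
      rw [ENNReal.tsum_mul_right, tsum_latticePath, mul_pow, mul_pow]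
      ring
    simp_rw [hn]
    rw [ENNReal.tsum_mul_left, ENNReal.tsum_geometric]
    refine ENNReal.mul_ne_top ENNReal.coe_ne_top (ENNReal.inv_ne_top.2 ?_)
    exact (tsub_pos_of_lt h).ne'
  filter_upwards [ae_all_iff.2 key] with ω hω x
  refine ne_top_of_le_ne_top (hω (site (x : EuclideanSpace ℝ (Fin d)))).ne ?_
  refine ENNReal.tsum_le_tsum fun n => ?_
  gcongr
  exact pathSum_le_tsum_cellCount (hΩ.locallyFinite ω) hα x n

/-! ### Constants -/

theorem r₀_lt_half : r₀ < 1 / 2 := by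
  obtain ⟨⟨h0, h1⟩, h⟩ := Classical.choose_spec existsUnique_r₀.exists
  change 0 ≤ r₀ at h0
  change r₀ ≤ 1 at h1
  change r₀ / (1 - r₀) ^ 2 - r₀ = 1 / 2 at h
  by_contra! hc
  rcases h1.eq_or_lt with h1 | h1
  -- At `r₀ = 1` division by zero yields `0`, so the equation would read `-1 = 1/2`.
  · rw [h1] at h
    norm_num at h
  · have h3 : 0 < (1 - r₀) ^ 2 := pow_pos (by linarith) 2
    have h4 : r₀ = (r₀ + 1 / 2) * (1 - r₀) ^ 2 := by
      rw [← div_eq_iff h3.ne']; linarith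
    nlinarith [mul_nonneg h0 (sub_nonneg.2 h1.le)]

/-- The exponential factor is at least `1` and the denominator is at most `1`. -/
theorem le_Cρ {ρ : ℝ} (h0 : 0 ≤ ρ) (h1 : ρ < 1 / 2) : ρ ≤ Cρ ρ := by
  rw [Cρ, le_div_iff₀ (by linarith)]
  have : 1 ≤ Real.exp (-ρ + 1 / 2) := Real.one_le_exp (by linarith)
  nlinarith

end SpatialPerm
end

theorem theorem3 {d : ℕ} (hd : 0 < d) (ρ : ℝ≥0) (hρ₀ : 0 < ρ) (hρ₁ : (ρ : ℝ) < 1 / 2)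
    (hgood : SpatialPerm.IsGoodDensity (SpatialPerm.truncatedPotential d) ρ)
    (α : ℝ) (hα : 0 < α)
    (hαρ : ENNReal.ofReal (SpatialPerm.Cρ ρ) *
      SpatialPerm.phi (SpatialPerm.truncatedPotential d) α < ENNReal.ofReal SpatialPerm.r₀)
    {E : Type*} [MeasurableSpace E] (P : Measure E) [IsProbabilityMeasure P]
    (Ω : E → Set (EuclideanSpace ℝ (Fin d))) (hΩ : SpatialPerm.IsPoissonProcess P ρ Ω) :
    ∀ᵐ ω ∂P, ∃! μ : Measure (Equiv.Perm (Ω ω)),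
      SpatialPerm.IsGibbs (Ω ω) α μ ∧ ∀ᵐ σ ∂μ, SpatialPerm.IsFiniteCyclePerm σ := by
  have hsmall : 2 * (ρ * SpatialPerm.phi (SpatialPerm.truncatedPotential d) α) < 1 := by
    have h1 : (ρ : ℝ≥0∞) * SpatialPerm.phi (SpatialPerm.truncatedPotential d) α <
        ENNReal.ofReal (1 / 2) := by
      refine lt_of_le_of_lt ?_ (hαρ.trans_le
        (ENNReal.ofReal_le_ofReal SpatialPerm.r₀_lt_half.le))
      gcongr
      rw [← ENNReal.ofReal_coe_nnreal]
      exact ENNReal.ofReal_le_ofReal (SpatialPerm.le_Cρ ρ.coe_nonneg hρ₁)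
    have h2 : ENNReal.ofReal (1 / 2) = 2⁻¹ := by
      rw [one_div, ENNReal.ofReal_inv_of_pos two_pos, ENNReal.ofReal_ofNat]
    rw [h2] at h1
    calc _ < 2 * 2⁻¹ := ENNReal.mul_lt_mul_right two_ne_zero ENNReal.ofNat_ne_top h1
      _ = 1 := ENNReal.mul_inv_cancel two_ne_zero ENNReal.ofNat_ne_top
  filter_upwards [hΩ.ae_isSubcritical hα.le hsmall] with ω hω
  have := SpatialPerm.discreteTopology_of_locallyFinite (hΩ.locallyFinite ω)
  have := SpatialPerm.countable_of_locallyFinite (hΩ.locallyFinite ω)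
  exact SpatialPerm.existsUnique_isGibbs (hΩ.locallyFinite ω) hα.le hω
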